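/- **Syntax.** Fix sets of constants $c$ and of confined constants $f$, each $f$ with an arity. Terms and confined terms are $$A,B,t,u ::= x \mid c \mid s \mid (x:A)\to B \mid x.t \mid t\,u \mid (i:A)\to B \mid i.t \mid t\,l,\qquad l ::= i \mid f(l_1,\dots,l_n),$$ where $s\in\{\mathsf{Type},\mathsf{Kind}\}$, $x$ ranges over regular variables, $i$ over confined variables, and $n$ is the arity of $f$. A signature is a finite list of entries $c:A$, $c:A:=t$ or $f:(i_1:B_1,\dots,i_n:B_n)\to A$ in which no constant is declared twice. A theory $\mathbb T=(\Sigma,\mathcal R,\mathcal E)$ is a signature with a set $\mathcal R$ of rewrite rules $c\,\vec a\longrightarrow u$ (with $\mathrm{fv}(u)\subseteq\mathrm{fv}(c\,\vec a)$) and a set $\mathcal E$ of equations between confined terms. **Reduction and conversion.** $\longrightarrow_\beta$ and $\longrightarrow_{\beta_c}$ are the closures by context of $(x.t)u\longrightarrow t[x\mapsto u]$ and $(i.t)l\longrightarrow t[i\mapsto l]$; $\longrightarrow_{\mathcal R}$ is the closure of $\mathcal R$ by context and substitution; $\longrightarrow_\delta$ is the closure by context of $c\longrightarrow t$ for the definitions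 $c:A:=t$ in $\Sigma$; and $\longrightarrow$ is the union of these four relations. $\simeq$ is the reflexive-symmetric-transitive closure of $\mathcal E$ by context and substitution, and $\equiv$ is the reflexive-symmetric-transitive closure of $\longrightarrow\cup\simeq$, both on terms whose constants are declared in $\Sigma$. **Typing.** A context $\Gamma$ is a finite list of entries $x:A$ and $i:A$. The judgments $\Gamma\vdash$, $\Gamma\vdash t:A$ and $\Gamma\vdash l:A$ are generated by the following rules. * $\cdot\vdash$; if $\Gamma\vdash A:\mathsf{Type}$ then $\Gamma,x:A\vdash$ and $\Gamma,i:A\vdash$. * If $\Gamma\vdash$, then $\Gamma\vdash\mathsf{Type}:\mathsf{Kind}$; $\Gamma\vdash x:A$ for $x:A\in\Gamma$; $\Gamma\vdash i:A$ for $i:A\in\Gamma$; $\Gamma\vdash c:A$ for $c:A\in\Sigma$ or $c:A:=u\in\Sigma$; and, for $f:(i_1:B_1,\dots,i_n:B_n)\to A\in\Sigma$, if $\Gamma\vdash l_k:B_k[i_1\mapsto l_1,\dots,i_{k-1}\mapsto l_{k-1}]$ for all $k$, then $\Gamma\vdash f(\vec l):A[\vec i\mapsto\vec l]$. * If $\Gamma\vdash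 t:A$, $\Gamma\vdash B:s$ and $A\equiv B$, then $\Gamma\vdash t:B$. If $\Gamma\vdash l:A$, $\Gamma\vdash B:\mathsf{Type}$ and $A\equiv B$, then $\Gamma\vdash l:B$. * If $\Gamma\vdash A:\mathsf{Type}$ and $\Gamma,x:A\vdash B:s$, then $\Gamma\vdash(x:A)\to B:s$; if moreover $\Gamma,x:A\vdash t:B$, then $\Gamma\vdash x.t:(x:A)\to B$. The same two rules hold with a confined variable $i$ in place of $x$. * If $\Gamma\vdash t:(x:A)\to B$ and $\Gamma\vdash u:A$, then $\Gamma\vdash t\,u:B[x\mapsto u]$. If $\Gamma\vdash t:(i:A)\to B$ and $\Gamma\vdash l:A$, then $\Gamma\vdash t\,l:B[i\mapsto l]$. A signature entry $c:A$, $c:A:=t$ or $f:\Delta\to A$ is valid in a theory if in that theory, respectively, $\vdash A:s$ for some sort $s$, $\vdash t:A$, or $\Delta\vdash A:\mathsf{Type}$. A theory is well-formed if every entry of its signature is valid in the theory formed by the prefix of the signature preceding the entry and those rules and equations that contain only constants of this prefix. **The theory $\mathbb{UPP}$.** Its signature consists, in this order, of $\mathsf{Lvl}:\mathsf{Type}$,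 the confined constants $0:()\to\mathsf{Lvl}$, $\mathsf S:(i:\mathsf{Lvl})\to\mathsf{Lvl}$ and $\sqcup:(i:\mathsf{Lvl},i':\mathsf{Lvl})\to\mathsf{Lvl}$, and \begin{align*} &\mathsf{Ty}:(l:\mathsf{Lvl})\to\mathsf{Type},\qquad \mathsf{Tm}:(l:\mathsf{Lvl})\to\mathsf{Ty}\,l\to\mathsf{Type},\qquad \mathsf U:(l:\mathsf{Lvl})\to\mathsf{Ty}\,(\mathsf S\,l),\\ &\Pi:(l\,l':\mathsf{Lvl})\to(A:\mathsf{Ty}\,l)\to(B:\mathsf{Tm}\,l\,A\to\mathsf{Ty}\,l')\to\mathsf{Ty}\,(l\sqcup l'),\\ &\lambda:(l\,l':\mathsf{Lvl})\to(A:\mathsf{Ty}\,l)\to(B:\mathsf{Tm}\,l\,A\to\mathsf{Ty}\,l')\to((x:\mathsf{Tm}\,l\,A)\to\mathsf{Tm}\,l'\,(B\,x))\to\mathsf{Tm}\,(l\sqcup l')\,(\Pi\,l\,l'\,A\,B),\\ &@:(l\,l':\mathsf{Lvl})\to(A:\mathsf{Ty}\,l)\to(B:\mathsf{Tm}\,l\,A\to\mathsf{Ty}\,l')\to(t:\mathsf{Tm}\,(l\sqcup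 l')\,(\Pi\,l\,l'\,A\,B))\to(u:\mathsf{Tm}\,l\,A)\to\mathsf{Tm}\,l'\,(B\,u), \end{align*} where $l,l'$ are confined variables. Its rewrite rules are $$\mathsf{Tm}\,l'\,(\mathsf U\,l)\longrightarrow\mathsf{Ty}\,l,\qquad @\,l\,l'\,A\,B\,(\lambda\,l''\,l'''\,A'\,B'\,t)\,u\longrightarrow t\,u,$$ and its equations are \begin{align*} i_1\sqcup(i_2\sqcup i_3)&\simeq(i_1\sqcup i_2)\sqcup i_3, & \mathsf S(i_1\sqcup i_2)&\simeq\mathsf S\,i_1\sqcup\mathsf S\,i_2, & i\sqcup0&\simeq i,\\ i_1\sqcup i_2&\simeq i_2\sqcup i_1, & i\sqcup\mathsf S\,i&\simeq\mathsf S\,i, & i\sqcup i&\simeq i. \end{align*} A local signature well-formed in $\mathbb{UPP}$ is a signature $\Phi$ without confined constants such that the theory $\mathbb{UPP},\Phi$, obtained by appending $\Phi$ to the signature of $\mathbb{UPP}$ and keeping its rules and equations, is well-formed. **Proposition (Subject Reduction).** Let $\Phi$ be a local signature well-formed in $\mathbb{UPP}$. In the theory $\mathbb{UPP},\Phi$,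 if $\Gamma\vdash t:A$ and $t\longrightarrow t'$ (one step of $\beta$, $\beta_c$, $\delta$ or the rewrite rules), then $\Gamma\vdash t':A$. -/

import Mathlib

/-! # Dedukti with confinement and rewriting modulo

Terms are represented with de Bruijn indices.  Regular and confined variables live in two separate
index spaces: a regular index counts only the enclosing regular binders, a confined index counts
only the enclosing confined binders. -/

namespace Dedukti

universe u v

/-- Confined terms `l ::= i | f(l₁, …, lₙ)` with `n` the arity of `f`. -/
inductive CTerm {F : Type v} (ar : F → ℕ) : Type v
  | ivar (n : ℕ) : CTerm ar
  | fn (f : F) (ls : Fin (ar f) → CTerm ar) : CTerm ar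

/-- The sorts `Type` and `Kind`. -/
inductive Srt : Type
  | type
  | kind

/-- Terms `x | c | s | (x : A) → B | x. t | t u | (i : A) → B | i. t | t l`.  The second argument of
`pi`, and the argument of `abs`, bind a regular variable; the second argument of `piC`, and the
argument of `absC`, bind a confined variable. -/
inductive Term (C : Type u) {F : Type v} (ar : F → ℕ) : Type (max u v)
  | var (n : ℕ) : Term C ar
  | const (c : C) : Term C ar
  | sort (s : Srt) : Term C ar
  | pi (A B : Term C ar) : Term C ar
  | abs (t : Term C ar) : Term C ar
  | app (t u : Term C ar) : Term C ar
  | piC (A B : Term C ar) : Term C ar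
  | absC (t : Term C ar) : Term C ar
  | appC (t : Term C ar) (l : CTerm ar) : Term C ar

variable {C : Type u} {F : Type v} {ar : F → ℕ}

/-! ## Renaming and substitution -/

/-- The extension of a sequence `f` by a new value at index `0`. -/
def scons {α : Type*} (a : α) (f : ℕ → α) : ℕ → α
  | 0 => a
  | n + 1 => f n

/-- The lifting of a renaming under one binder. -/
def liftRen (ρ : ℕ → ℕ) : ℕ → ℕ := scons 0 (fun n => ρ n + 1)

/-- Renaming of the variables of a confined term. -/
def CTerm.rename (ξ : ℕ → ℕ) : CTerm ar → CTerm ar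
  | .ivar n => .ivar (ξ n)
  | .fn f ls => .fn f (fun k => (ls k).rename ξ)

/-- Substitution in a confined term. -/
def CTerm.subst (τ : ℕ → CTerm ar) : CTerm ar → CTerm ar
  | .ivar n => τ n
  | .fn f ls => .fn f (fun k => (ls k).subst τ)

/-- Renaming of the regular variables by `ρ` and of the confined variables by `ξ`. -/
def Term.rename : (ℕ → ℕ) → (ℕ → ℕ) → Term C ar → Term C ar
  | ρ, _, .var n => .var (ρ n)
  | _, _, .const c => .const c
  | _, _, .sort s => .sort s
  | ρ, ξ, .pi A B => .pi (A.rename ρ ξ) (B.rename (liftRen ρ) ξ)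
  | ρ, ξ, .abs t => .abs (t.rename (liftRen ρ) ξ)
  | ρ, ξ, .app t u => .app (t.rename ρ ξ) (u.rename ρ ξ)
  | ρ, ξ, .piC A B => .piC (A.rename ρ ξ) (B.rename ρ (liftRen ξ))
  | ρ, ξ, .absC t => .absC (t.rename ρ (liftRen ξ))
  | ρ, ξ, .appC t l => .appC (t.rename ρ ξ) (l.rename ξ)

/-- Weakening of a term by one regular variable. -/
def Term.shift (t : Term C ar) : Term C ar := t.rename Nat.succ id

/-- Weakening of a term by one confined variable. -/
def Term.shiftC (t : Term C ar) : Term C ar := t.rename id Nat.succ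

/-- Weakening of a confined term by one confined variable. -/
def CTerm.shiftC (l : CTerm ar) : CTerm ar := l.rename Nat.succ

/-- Simultaneous capture-avoiding substitution: regular variables are replaced by terms through
`σ`, confined variables by confined terms through `τ`. -/
def Term.subst : (ℕ → Term C ar) → (ℕ → CTerm ar) → Term C ar → Term C ar
  | σ, _, .var n => σ n
  | _, _, .const c => .const c
  | _, _, .sort s => .sort s
  | σ, τ, .pi A B => .pi (A.subst σ τ) (B.subst (scons (.var 0) (fun n => (σ n).shift)) τ)
  | σ, τ, .abs t => .abs (t.subst (scons (.var 0) (fun n => (σ n).shift)) τ)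
  | σ, τ, .app t u => .app (t.subst σ τ) (u.subst σ τ)
  | σ, τ, .piC A B =>
      .piC (A.subst σ τ)
        (B.subst (fun n => (σ n).shiftC) (scons (.ivar 0) (fun n => (τ n).shiftC)))
  | σ, τ, .absC t =>
      .absC (t.subst (fun n => (σ n).shiftC) (scons (.ivar 0) (fun n => (τ n).shiftC)))
  | σ, τ, .appC t l => .appC (t.subst σ τ) (l.subst τ)

/-- `t[x ↦ u]` for the last regular variable `x`. -/
def Term.inst (t u : Term C ar) : Term C ar := t.subst (scons u Term.var) CTerm.ivar

/-- `t[i ↦ l]` for the last confined variable `i`. -/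
def Term.instC (t : Term C ar) (l : CTerm ar) : Term C ar := t.subst Term.var (scons l CTerm.ivar)

/-- For `ls = (l₁, …, lₙ)` and `k ≤ n`, the substitution `i₁ ↦ l₁, …, iₖ ↦ lₖ` for the last `k`
confined variables `i₁, …, iₖ`; the most recent one, `iₖ`, has index `0`. -/
def prefixSubst {n : ℕ} (ls : Fin n → CTerm ar) (k : ℕ) (hk : k ≤ n) (m : ℕ) : CTerm ar :=
  if h : m < k then ls ⟨k - 1 - m, by omega⟩ else .ivar (m - k)

/-! ## Free variables and constants of a term -/

/-- The confined variable `n` occurs in the confined term. -/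
def CTerm.HasVar : ℕ → CTerm ar → Prop
  | n, .ivar m => m = n
  | n, .fn _ ls => ∃ k, (ls k).HasVar n

/-- The regular variable `n` occurs free in the term. -/
def Term.HasVar : ℕ → Term C ar → Prop
  | n, .var m => m = n
  | _, .const _ => False
  | _, .sort _ => False
  | n, .pi A B => A.HasVar n ∨ B.HasVar (n + 1)
  | n, .abs t => t.HasVar (n + 1)
  | n, .app t u => t.HasVar n ∨ u.HasVar n
  | n, .piC A B => A.HasVar n ∨ B.HasVar n
  | n, .absC t => t.HasVar n
  | n, .appC t _ => t.HasVar n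

/-- The confined variable `n` occurs free in the term. -/
def Term.HasVarC : ℕ → Term C ar → Prop
  | _, .var _ => False
  | _, .const _ => False
  | _, .sort _ => False
  | n, .pi A B => A.HasVarC n ∨ B.HasVarC n
  | n, .abs t => t.HasVarC n
  | n, .app t u => t.HasVarC n ∨ u.HasVarC n
  | n, .piC A B => A.HasVarC n ∨ B.HasVarC (n + 1)
  | n, .absC t => t.HasVarC (n + 1)
  | n, .appC t l => t.HasVarC n ∨ l.HasVar n

/-- All confined constants of the confined term satisfy `Q`. -/
def CTerm.Over (Q : F → Prop) : CTerm ar → Prop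
  | .ivar _ => True
  | .fn f ls => Q f ∧ ∀ k, (ls k).Over Q

/-- All constants of the term satisfy `P` and all its confined constants satisfy `Q`. -/
def Term.Over (P : C → Prop) (Q : F → Prop) : Term C ar → Prop
  | .var _ => True
  | .const c => P c
  | .sort _ => True
  | .pi A B => A.Over P Q ∧ B.Over P Q
  | .abs t => t.Over P Q
  | .app t u => t.Over P Q ∧ u.Over P Q
  | .piC A B => A.Over P Q ∧ B.Over P Q
  | .absC t => t.Over P Q
  | .appC t l => t.Over P Q ∧ l.Over Q

/-! ## Signatures, rewrite rules, theories -/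

/-- Signature entries: `c : A`, `c : A := t` and `f : (i₁ : B₁, …, iₙ : Bₙ) → A` with `n` the arity
of `f`.  In a confined entry `Δ k` may use the confined variables `0, …, k - 1` and `A` may use the
confined variables `0, …, n - 1`, the index `0` being the most recent one. -/
inductive Decl (C : Type u) {F : Type v} (ar : F → ℕ) : Type (max u v)
  | const (c : C) (A : Term C ar) : Decl C ar
  | defn (c : C) (A t : Term C ar) : Decl C ar
  | conf (f : F) (Δ : Fin (ar f) → Term C ar) (A : Term C ar) : Decl C ar

/-- The constant or confined constant that an entry declares. -/
def Decl.name : Decl C ar → C ⊕ F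
  | .const c _ => .inl c
  | .defn c _ _ => .inl c
  | .conf f _ _ => .inr f

/-- The entry declares a confined constant. -/
def Decl.IsConfined : Decl C ar → Prop
  | .const _ _ => False
  | .defn _ _ _ => False
  | .conf _ _ _ => True

/-- The application of a term to a list of terms and confined terms. -/
def Term.spine (t : Term C ar) (as : List (Term C ar ⊕ CTerm ar)) : Term C ar :=
  as.foldl (fun s a => Sum.elim s.app s.appC a) t

/-- Rewrite rules `c a₁ … aₖ ⟶ u` with `fv(u) ⊆ fv(c a₁ … aₖ)`.  The free variables of the two
sides, regular and confined, are the variables of the rule. -/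
structure Rule (C : Type u) {F : Type v} (ar : F → ℕ) where
  head : C
  args : List (Term C ar ⊕ CTerm ar)
  rhs : Term C ar
  fv_rhs : ∀ n, rhs.HasVar n → ((Term.const head).spine args).HasVar n
  fvC_rhs : ∀ n, rhs.HasVarC n → ((Term.const head).spine args).HasVarC n

/-- The left-hand side of a rewrite rule. -/
def Rule.lhs (r : Rule C ar) : Term C ar := (Term.const r.head).spine r.args

/-- A theory: a signature (in order of declaration), a set of rewrite rules and a set of equations
between confined terms. -/
structure Theory (C : Type u) {F : Type v} (ar : F → ℕ) where
  sig : List (Decl C ar)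
  rules : Set (Rule C ar)
  eqs : Set (CTerm ar × CTerm ar)

/-- The constant `c` is declared in the signature. -/
def DeclaredIn (S : List (Decl C ar)) (c : C) : Prop := Sum.inl c ∈ S.map Decl.name

/-- The confined constant `f` is declared in the signature. -/
def DeclaredInC (S : List (Decl C ar)) (f : F) : Prop := Sum.inr f ∈ S.map Decl.name

/-- The term contains only constants and confined constants declared in the signature. -/
def Term.OverSig (S : List (Decl C ar)) (t : Term C ar) : Prop :=
  t.Over (DeclaredIn S) (DeclaredInC S)

/-! ## Reduction and conversion -/

/-- Closure by context of a relation on confined terms. -/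
inductive CompatC (Q : CTerm ar → CTerm ar → Prop) : CTerm ar → CTerm ar → Prop
  | root {l l'} : Q l l' → CompatC Q l l'
  | fn {f : F} {ls : Fin (ar f) → CTerm ar} {k : Fin (ar f)} {l'} :
      CompatC Q (ls k) l' → CompatC Q (.fn f ls) (.fn f (Function.update ls k l'))

/-- Closure by context, on terms, of a relation `R` on terms and a relation `Q` on confined
terms. -/
inductive Compat (R : Term C ar → Term C ar → Prop) (Q : CTerm ar → CTerm ar → Prop) :
    Term C ar → Term C ar → Prop
  | root {t t'} : R t t' → Compat R Q t t'
  | piL {A A' B} : Compat R Q A A' → Compat R Q (.pi A B) (.pi A' B)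
  | piR {A B B'} : Compat R Q B B' → Compat R Q (.pi A B) (.pi A B')
  | abs {t t'} : Compat R Q t t' → Compat R Q (.abs t) (.abs t')
  | appL {t t' u} : Compat R Q t t' → Compat R Q (.app t u) (.app t' u)
  | appR {t u u'} : Compat R Q u u' → Compat R Q (.app t u) (.app t u')
  | piCL {A A' B} : Compat R Q A A' → Compat R Q (.piC A B) (.piC A' B)
  | piCR {A B B'} : Compat R Q B B' → Compat R Q (.piC A B) (.piC A B')
  | absC {t t'} : Compat R Q t t' → Compat R Q (.absC t) (.absC t')
  | appCL {t t' l} : Compat R Q t t' → Compat R Q (.appC t l) (.appC t' l)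
  | appCR {t l l'} : CompatC Q l l' → Compat R Q (.appC t l) (.appC t l')

/-- Closure by context of a relation on terms. -/
def CtxClosure (R : Term C ar → Term C ar → Prop) : Term C ar → Term C ar → Prop :=
  Compat R (fun _ _ => False)

/-- `(x. t) u ⟶ t[x ↦ u]` at the root. -/
inductive BetaRoot : Term C ar → Term C ar → Prop
  | mk (t u : Term C ar) : BetaRoot (.app (.abs t) u) (t.inst u)

/-- `(i. t) l ⟶ t[i ↦ l]` at the root. -/
inductive BetaCRoot : Term C ar → Term C ar → Prop
  | mk (t : Term C ar) (l : CTerm ar) : BetaCRoot (.appC (.absC t) l) (t.instC l)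

namespace Theory

variable (T : Theory C ar)

/-- `c ⟶ t` at the root, for a definition `c : A := t` of the signature. -/
inductive DeltaRoot : Term C ar → Term C ar → Prop
  | mk {c : C} {A t : Term C ar} : Decl.defn c A t ∈ T.sig → DeltaRoot (.const c) t

/-- Instances of the rewrite rules at the root. -/
inductive RuleRoot : Term C ar → Term C ar → Prop
  | mk {r : Rule C ar} (hr : r ∈ T.rules) (σ : ℕ → Term C ar) (τ : ℕ → CTerm ar) :
      RuleRoot (r.lhs.subst σ τ) (r.rhs.subst σ τ)

/-- Instances of the equations at the root. -/
inductive EqRoot : CTerm ar → CTerm ar → Prop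
  | mk {e : CTerm ar × CTerm ar} (he : e ∈ T.eqs) (τ : ℕ → CTerm ar) :
      EqRoot (e.1.subst τ) (e.2.subst τ)

/-- One-step reduction: the union of the relations for `β`, `β_c`, the rewrite rules and `δ`. -/
def Step (t t' : Term C ar) : Prop :=
  CtxClosure BetaRoot t t' ∨ CtxClosure BetaCRoot t t' ∨ CtxClosure T.RuleRoot t t' ∨
    CtxClosure T.DeltaRoot t t'

/-- The relation `≃` on the terms of the theory: the reflexive-symmetric-transitive closure by
context and substitution of the equations. -/
def Sim : Term C ar → Term C ar → Prop :=
  Relation.EqvGen fun t u =>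
    t.OverSig T.sig ∧ u.OverSig T.sig ∧ Compat (fun _ _ => False) T.EqRoot t u

/-- Conversion `≡` on the terms of the theory: the reflexive-symmetric-transitive closure of the
union of one-step reduction and `≃`. -/
def Conv : Term C ar → Term C ar → Prop :=
  Relation.EqvGen fun t u =>
    t.OverSig T.sig ∧ u.OverSig T.sig ∧ (T.Step t u ∨ T.Sim t u)

end Theory

/-! ## Contexts and typing -/

/-- Context entries `x : A` and `i : A`. -/
inductive Entry (C : Type u) {F : Type v} (ar : F → ℕ) : Type (max u v)
  | reg (A : Term C ar) : Entry C ar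
  | conf (A : Term C ar) : Entry C ar

/-- Contexts; the head of the list is the most recent entry. -/
abbrev Ctx (C : Type u) {F : Type v} (ar : F → ℕ) : Type (max u v) := List (Entry C ar)

/-- `x : A ∈ Γ` for the regular variable `x` of index `n`; the type is weakened to `Γ`. -/
inductive LookupVar : Ctx C ar → ℕ → Term C ar → Prop
  | here {Γ A} : LookupVar (.reg A :: Γ) 0 A.shift
  | thereReg {Γ n A B} : LookupVar Γ n A → LookupVar (.reg B :: Γ) (n + 1) A.shift
  | thereConf {Γ n A B} : LookupVar Γ n A → LookupVar (.conf B :: Γ) n A.shiftC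

/-- `i : A ∈ Γ` for the confined variable `i` of index `n`; the type is weakened to `Γ`. -/
inductive LookupVarC : Ctx C ar → ℕ → Term C ar → Prop
  | here {Γ A} : LookupVarC (.conf A :: Γ) 0 A.shiftC
  | thereReg {Γ n A B} : LookupVarC Γ n A → LookupVarC (.reg B :: Γ) n A.shift
  | thereConf {Γ n A B} : LookupVarC Γ n A → LookupVarC (.conf B :: Γ) (n + 1) A.shiftC

mutual

/-- `Γ ⊢` -/
inductive WfCtx (T : Theory C ar) : Ctx C ar → Prop
  | empty : WfCtx T []
  | ext {Γ A} : HasType T Γ A (.sort .type) → WfCtx T (.reg A :: Γ)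
  | extC {Γ A} : HasType T Γ A (.sort .type) → WfCtx T (.conf A :: Γ)

/-- `Γ ⊢ t : A` -/
inductive HasType (T : Theory C ar) : Ctx C ar → Term C ar → Term C ar → Prop
  | sort {Γ} : WfCtx T Γ → HasType T Γ (.sort .type) (.sort .kind)
  | var {Γ n A} : WfCtx T Γ → LookupVar Γ n A → HasType T Γ (.var n) A
  | const {Γ c A} : WfCtx T Γ → Decl.const c A ∈ T.sig → HasType T Γ (.const c) A
  | defn {Γ c A u} : WfCtx T Γ → Decl.defn c A u ∈ T.sig → HasType T Γ (.const c) A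
  | conv {Γ t A B s} : HasType T Γ t A → HasType T Γ B (.sort s) → T.Conv A B → HasType T Γ t B
  | pi {Γ A B s} : HasType T Γ A (.sort .type) → HasType T (.reg A :: Γ) B (.sort s) →
      HasType T Γ (.pi A B) (.sort s)
  | piC {Γ A B s} : HasType T Γ A (.sort .type) → HasType T (.conf A :: Γ) B (.sort s) →
      HasType T Γ (.piC A B) (.sort s)
  | abs {Γ A B t s} : HasType T Γ A (.sort .type) → HasType T (.reg A :: Γ) B (.sort s) →
      HasType T (.reg A :: Γ) t B → HasType T Γ (.abs t) (.pi A B)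
  | absC {Γ A B t s} : HasType T Γ A (.sort .type) → HasType T (.conf A :: Γ) B (.sort s) →
      HasType T (.conf A :: Γ) t B → HasType T Γ (.absC t) (.piC A B)
  | app {Γ A B t u} : HasType T Γ t (.pi A B) → HasType T Γ u A →
      HasType T Γ (.app t u) (B.inst u)
  | appC {Γ A B t l} : HasType T Γ t (.piC A B) → HasTypeC T Γ l A →
      HasType T Γ (.appC t l) (B.instC l)

/-- `Γ ⊢ l : A` -/
inductive HasTypeC (T : Theory C ar) : Ctx C ar → CTerm ar → Term C ar → Prop
  | ivar {Γ n A} : WfCtx T Γ → LookupVarC Γ n A → HasTypeC T Γ (.ivar n) A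
  | fn {Γ f Δ A} {ls : Fin (ar f) → CTerm ar} : WfCtx T Γ → Decl.conf f Δ A ∈ T.sig →
      (∀ k : Fin (ar f), HasTypeC T Γ (ls k) ((Δ k).subst .var (prefixSubst ls k k.isLt.le))) →
      HasTypeC T Γ (.fn f ls) (A.subst .var (prefixSubst ls (ar f) le_rfl))
  | conv {Γ l A B} : HasTypeC T Γ l A → HasType T Γ B (.sort .type) → T.Conv A B →
      HasTypeC T Γ l B

end

/-! ## Well-formed theories -/

/-- Validity of a signature entry in a theory. -/
def Decl.Valid (T : Theory C ar) : Decl C ar → Prop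
  | .const _ A => ∃ s, HasType T [] A (.sort s)
  | .defn _ A t => HasType T [] t A
  | .conf _ Δ A => HasType T ((List.ofFn Δ).reverse.map Entry.conf) A (.sort .type)

/-- The theory with signature `S` whose rules and equations are those of `T` that contain only
constants declared in `S`. -/
def Theory.restrict (T : Theory C ar) (S : List (Decl C ar)) : Theory C ar where
  sig := S
  rules := {r ∈ T.rules | r.lhs.OverSig S ∧ r.rhs.OverSig S}
  eqs := {e ∈ T.eqs | e.1.Over (DeclaredInC S) ∧ e.2.Over (DeclaredInC S)}

/-- A theory is well-formed when no constant is declared twice and every signature entry is valid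
in the restriction of the theory to the prefix of the signature that precedes the entry. -/
def Theory.WellFormed (T : Theory C ar) : Prop :=
  (T.sig.map Decl.name).Nodup ∧
    ∀ S d S', T.sig = S ++ d :: S' → d.Valid (T.restrict S)

/-- The extension of the signature of a theory. -/
def Theory.extend (T : Theory C ar) (Φ : List (Decl C ar)) : Theory C ar where
  sig := T.sig ++ Φ
  rules := T.rules
  eqs := T.eqs

/-- `Φ` is a well-formed local signature in `T`: it declares no confined constant, and the
extension of `T` by `Φ` is well-formed. -/
def Theory.IsLocalSignature (T : Theory C ar) (Φ : List (Decl C ar)) : Prop :=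
  (∀ d ∈ Φ, ¬ d.IsConfined) ∧ (T.extend Φ).WellFormed

end Dedukti

/-! # The theory UPP -/

namespace UPP

open Dedukti

universe w

/-- The constants of UPP, together with names for the constants of a local signature. -/
inductive Const (L : Type w) : Type w
  | Lvl
  | Ty
  | Tm
  | U
  | Pi
  | Lam
  | App
  | loc (c : L)

/-- The confined constants of UPP. -/
inductive Conf : Type
  | zero
  | succ
  | max

/-- The arities of the confined constants. -/
def arity : Conf → ℕ
  | .zero => 0
  | .succ => 1
  | .max => 2

/-- Levels. -/
abbrev Level : Type := CTerm arity

/-- Terms of UPP with local constants named by `L`. -/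
abbrev Trm (L : Type w) : Type w := Term (Const L) arity

/-- The level `0`. -/
def zero : Level := .fn .zero ![]

/-- The level `S l`. -/
def succ (l : Level) : Level := .fn .succ ![l]

/-- The level `l ⊔ l'`. -/
def max (l l' : Level) : Level := .fn .max ![l, l']

/-- The confined variable of index `n`. -/
def i (n : ℕ) : Level := .ivar n

variable {L : Type w}

/-- The regular variable of index `n`. -/
def x (n : ℕ) : Trm L := .var n

/-- The sort `Type`. -/
def type : Trm L := .sort .type

/-- `Lvl` -/
def Lvl : Trm L := .const .Lvl

/-- `Ty l` -/
def Ty (l : Level) : Trm L := .appC (.const .Ty) l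

/-- `Tm l A` -/
def Tm (l : Level) (A : Trm L) : Trm L := .app (.appC (.const .Tm) l) A

/-- `U l` -/
def U (l : Level) : Trm L := .appC (.const .U) l

/-- `Π l l' A B` -/
def Pi (l l' : Level) (A B : Trm L) : Trm L :=
  .app (.app (.appC (.appC (.const .Pi) l) l') A) B

/-- `(l : Lvl) → Type` -/
def tyType : Trm L := .piC Lvl type

/-- `(l : Lvl) → Ty l → Type` -/
def tmType : Trm L := .piC Lvl (.pi (Ty (i 0)) type)

/-- `(l : Lvl) → Ty (S l)` -/
def uType : Trm L := .piC Lvl (Ty (succ (i 0)))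

/-- `(l l' : Lvl) → (A : Ty l) → (B : Tm l A → Ty l') → Ty (l ⊔ l')` -/
def piType : Trm L :=
  .piC Lvl <| .piC Lvl <| .pi (Ty (i 1)) <| .pi (.pi (Tm (i 1) (x 0)) (Ty (i 0))) <|
    Ty (max (i 1) (i 0))

/-- `(l l' : Lvl) → (A : Ty l) → (B : Tm l A → Ty l') → ((x : Tm l A) → Tm l' (B x)) →
Tm (l ⊔ l') (Π l l' A B)` -/
def lamType : Trm L :=
  .piC Lvl <| .piC Lvl <| .pi (Ty (i 1)) <| .pi (.pi (Tm (i 1) (x 0)) (Ty (i 0))) <|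
    .pi (.pi (Tm (i 1) (x 1)) (Tm (i 0) (.app (x 1) (x 0)))) <|
      Tm (max (i 1) (i 0)) (Pi (i 1) (i 0) (x 2) (x 1))

/-- `(l l' : Lvl) → (A : Ty l) → (B : Tm l A → Ty l') → (t : Tm (l ⊔ l') (Π l l' A B)) →
(u : Tm l A) → Tm l' (B u)` -/
def appType : Trm L :=
  .piC Lvl <| .piC Lvl <| .pi (Ty (i 1)) <| .pi (.pi (Tm (i 1) (x 0)) (Ty (i 0))) <|
    .pi (Tm (max (i 1) (i 0)) (Pi (i 1) (i 0) (x 1) (x 0))) <| .pi (Tm (i 1) (x 2)) <|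
      Tm (i 0) (.app (x 2) (x 0))

/-- The signature of UPP. -/
def sig (L : Type w) : List (Decl (Const L) arity) :=
  [.const .Lvl type,
   .conf .zero (fun _ => Lvl) Lvl,
   .conf .succ (fun _ => Lvl) Lvl,
   .conf .max (fun _ => Lvl) Lvl,
   .const .Ty tyType,
   .const .Tm tmType,
   .const .U uType,
   .const .Pi piType,
   .const .Lam lamType,
   .const .App appType]

/-- `Tm l' (U l) ⟶ Ty l`, where `l, l'` are the confined variables `0, 1`. -/
def ruleU (L : Type w) : Rule (Const L) arity where
  head := .Tm
  args := [.inr (i 1), .inl (U (i 0))]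
  rhs := Ty (i 0)
  fv_rhs := by simp [Ty, Term.HasVar]
  fvC_rhs := by simp [Ty, U, i, Term.spine, Term.HasVarC, CTerm.HasVar]

/-- `@ l l' A B (λ l'' l''' A' B' t) u ⟶ t u`, where `l, l', l'', l'''` are the confined variables
`0, …, 3` and `A, B, A', B', t, u` are the regular variables `0, …, 5`. -/
def ruleBeta (L : Type w) : Rule (Const L) arity where
  head := .App
  args := [.inr (i 0), .inr (i 1), .inl (x 0), .inl (x 1),
    .inl ((Term.const .Lam).spine
      [.inr (i 2), .inr (i 3), .inl (x 2), .inl (x 3), .inl (x 4)]),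
    .inl (x 5)]
  rhs := .app (x 4) (x 5)
  fv_rhs := by
    simp only [x, Term.spine, Term.HasVar, List.foldl, Sum.elim_inl, Sum.elim_inr]
    tauto
  fvC_rhs := by simp [x, Term.HasVarC]

/-- The equations on levels. -/
def eqs : Set (Level × Level) :=
  {(max (i 1) (max (i 2) (i 3)), max (max (i 1) (i 2)) (i 3)),
   (max (i 1) (i 2), max (i 2) (i 1)),
   (succ (max (i 1) (i 2)), max (succ (i 1)) (succ (i 2))),
   (max (i 0) (succ (i 0)), succ (i 0)),
   (max (i 0) zero, i 0),
   (max (i 0) (i 0), i 0)}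

/-- The theory UPP; `L` supplies the names that a local signature may use. -/
def theory (L : Type w) : Theory (Const L) arity where
  sig := sig L
  rules := {ruleU L, ruleBeta L}
  eqs := eqs

end UPP

-- The proof rests on injectivity of the type formers up to conversion. To type the contractum of
-- `(x. t) u`, inversion gives a product type for `x. t` in which the body is typed, and another
-- product type whose domain types `u`; the two products are only convertible, and their components
-- must be shown convertible too (`conv_pi_inj`, `conv_piC_inj`).
--
-- Injectivity comes from confluence on raw terms. Conversion mixes oriented reduction with
-- unoriented equations on levels, but a level contains no reducible term, and the rewrite rules are
-- left-linear with mere variables in level positions. Replacing a level by a convertible one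
-- therefore neither creates nor destroys a redex. The parallel reduction `Par` may change every
-- surviving level along the symmetric relation `LevelConv`; an equation then counts as a step, and
-- `Par.diamond` holds exactly. No definition competes with the rules, since names are unique and
-- the constants of UPP are declared without bodies. Hence convertible terms have a common reduct
-- (`conv_join`). Products reduce componentwise, and so does `Tm m (Π l k A B)`, which no rule
-- contracts (`conv_tm_pi_inj`).
--
-- Left-linearity has a price: the rule for `@` does not ask the annotations of `λ` to agree with
-- those of `@`. Typing supplies the agreement. The type of the `λ` term and the type expected by
-- `@` are convertible, and `conv_tm_pi_inj` turns this into conversions of levels, domains and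
-- codomains, which suffice to retype the contractum (`UPP.HasType.appLam`). Spines headed by a
-- constant are analysed with `Principal`, a type from which all other types of the term follow by
-- conversion.
--
-- Around this core stands the usual metatheory: substitution, inversion, and well-typedness of
-- types. It is developed for any theory satisfying `WellTyped`, in which all arguments and results
-- of a confined constant share one constant type. Validity of an entry refers only to the prefix
-- before it, so `WellTyped` is proved along the prefixes of the signature.

namespace Dedukti

universe u v

variable {C : Type u} {F : Type v} {ar : F → ℕ}

/-! ## Substitution calculus -/

/-- The lifting of a substitution of regular variables under a regular binder. -/
def up (σ : ℕ → Term C ar) : ℕ → Term C ar := scons (.var 0) (fun n => (σ n).shift)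

/-- The weakening of a substitution of regular variables under a confined binder. -/
def upShiftC (σ : ℕ → Term C ar) : ℕ → Term C ar := fun n => (σ n).shiftC

/-- The lifting of a substitution of confined variables under a confined binder. -/
def upC (τ : ℕ → CTerm ar) : ℕ → CTerm ar := scons (.ivar 0) (fun n => (τ n).shiftC)

namespace CTerm

theorem rename_eq_subst (l : CTerm ar) (ξ : ℕ → ℕ) :
    l.rename ξ = l.subst (fun n => .ivar (ξ n)) := by
  induction l with
  | ivar n => rfl
  | fn f ls ih => simp only [rename, subst, ih]

theorem subst_subst (l : CTerm ar) (τ τ' : ℕ → CTerm ar) :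
    (l.subst τ).subst τ' = l.subst (fun n => (τ n).subst τ') := by
  induction l with
  | ivar n => rfl
  | fn f ls ih => simp only [subst, ih]

@[simp]
theorem subst_ivar (l : CTerm ar) : l.subst .ivar = l := by
  induction l with
  | ivar n => rfl
  | fn f ls ih => simp only [subst, ih]

theorem subst_rename (l : CTerm ar) (ξ : ℕ → ℕ) (τ : ℕ → CTerm ar) :
    (l.rename ξ).subst τ = l.subst (fun n => τ (ξ n)) := by
  rw [rename_eq_subst, subst_subst]; rfl

theorem rename_subst (l : CTerm ar) (ξ : ℕ → ℕ) (τ : ℕ → CTerm ar) :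
    (l.subst τ).rename ξ = l.subst (fun n => (τ n).rename ξ) := by
  simp only [rename_eq_subst, subst_subst]

end CTerm

theorem up_var (ρ : ℕ → ℕ) :
    up (fun n => (.var (ρ n) : Term C ar)) = fun n => .var (liftRen ρ n) := by
  funext n; cases n <;> rfl

theorem upC_ivar (ξ : ℕ → ℕ) :
    upC (fun n => (.ivar (ξ n) : CTerm ar)) = fun n => .ivar (liftRen ξ n) := by
  funext n; cases n <;> rfl

theorem upShiftC_var (ρ : ℕ → ℕ) :
    upShiftC (fun n => (.var (ρ n) : Term C ar)) = fun n => .var (ρ n) := rfl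

@[simp]
theorem up_var_id : up (Term.var : ℕ → Term C ar) = .var := by
  funext n; cases n <;> rfl

@[simp]
theorem upC_ivar_id : upC (CTerm.ivar : ℕ → CTerm ar) = .ivar := by
  funext n; cases n <;> rfl

@[simp]
theorem upShiftC_var_id : upShiftC (Term.var : ℕ → Term C ar) = .var := rfl

namespace Term

section
variable (σ : ℕ → Term C ar) (τ : ℕ → CTerm ar)

@[simp] theorem subst_var (n : ℕ) : (Term.var n).subst σ τ = σ n := rfl
@[simp] theorem subst_const (c : C) : (Term.const c : Term C ar).subst σ τ = .const c := rfl
@[simp] theorem subst_sort (s : Srt) : (Term.sort s : Term C ar).subst σ τ = .sort s := rfl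
@[simp] theorem subst_pi (A B : Term C ar) :
    (Term.pi A B).subst σ τ = .pi (A.subst σ τ) (B.subst (up σ) τ) := rfl
@[simp] theorem subst_abs (t : Term C ar) : (Term.abs t).subst σ τ = .abs (t.subst (up σ) τ) := rfl
@[simp] theorem subst_app (t u : Term C ar) :
    (Term.app t u).subst σ τ = .app (t.subst σ τ) (u.subst σ τ) := rfl
@[simp] theorem subst_piC (A B : Term C ar) :
    (Term.piC A B).subst σ τ = .piC (A.subst σ τ) (B.subst (upShiftC σ) (upC τ)) := rfl
@[simp] theorem subst_absC (t : Term C ar) :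
    (Term.absC t).subst σ τ = .absC (t.subst (upShiftC σ) (upC τ)) := rfl
@[simp] theorem subst_appC (t : Term C ar) (l : CTerm ar) :
    (Term.appC t l).subst σ τ = .appC (t.subst σ τ) (l.subst τ) := rfl

end

theorem rename_eq_subst (t : Term C ar) (ρ ξ : ℕ → ℕ) :
    t.rename ρ ξ = t.subst (fun n => .var (ρ n)) (fun n => .ivar (ξ n)) := by
  induction t generalizing ρ ξ with
  | appC t l ih => simp only [rename, subst_appC, ih, CTerm.rename_eq_subst]
  | _ => simp_all [rename, up_var, upC_ivar, upShiftC_var]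

/-- The composition laws are proved in a forced order. Lifting a substitution under a binder renames
its values, so commuting two lifted substitutions already requires the laws that involve renamings.
-/
theorem subst_rename (t : Term C ar) (ρ ξ : ℕ → ℕ) (σ : ℕ → Term C ar) (τ : ℕ → CTerm ar) :
    (t.rename ρ ξ).subst σ τ = t.subst (fun n => σ (ρ n)) (fun n => τ (ξ n)) := by
  have h : ∀ (σ : ℕ → Term C ar) (ρ : ℕ → ℕ),
      (fun n => up σ (liftRen ρ n)) = up (fun n => σ (ρ n)) := by
    intro σ ρ; funext n; cases n <;> rfl
  have h' : ∀ (τ : ℕ → CTerm ar) (ξ : ℕ → ℕ),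
      (fun n => upC τ (liftRen ξ n)) = upC (fun n => τ (ξ n)) := by
    intro σ ρ; funext n; cases n <;> rfl
  have h'' : ∀ (σ : ℕ → Term C ar) (ρ : ℕ → ℕ),
      (fun n => upShiftC σ (ρ n)) = upShiftC (fun n => σ (ρ n)) := fun _ _ => rfl
  induction t generalizing ρ ξ σ τ with
  | appC t l ih => simp only [rename, subst_appC, ih, CTerm.subst_rename]
  | _ => simp_all [rename]

theorem rename_rename (t : Term C ar) (ρ ξ ρ' ξ' : ℕ → ℕ) :
    (t.rename ρ ξ).rename ρ' ξ' = t.rename (fun n => ρ' (ρ n)) (fun n => ξ' (ξ n)) := by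
  rw [rename_eq_subst _ ρ', subst_rename, rename_eq_subst]

theorem rename_subst (t : Term C ar) (ρ ξ : ℕ → ℕ) (σ : ℕ → Term C ar) (τ : ℕ → CTerm ar) :
    (t.subst σ τ).rename ρ ξ =
      t.subst (fun n => (σ n).rename ρ ξ) (fun n => (τ n).rename ξ) := by
  have h : ∀ (σ : ℕ → Term C ar) (ρ ξ : ℕ → ℕ),
      (fun n => (up σ n).rename (liftRen ρ) ξ) = up (fun n => (σ n).rename ρ ξ) := by
    intro σ ρ ξ; funext n
    cases n
    · rfl
    · simp only [up, scons, shift, rename_rename]; rfl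
  have h' : ∀ (τ : ℕ → CTerm ar) (ξ : ℕ → ℕ),
      (fun n => (upC τ n).rename (liftRen ξ)) = upC (fun n => (τ n).rename ξ) := by
    intro τ ξ; funext n
    cases n
    · rfl
    · simp only [upC, scons, CTerm.shiftC, CTerm.rename_eq_subst, CTerm.subst_subst]; rfl
  have h'' : ∀ (σ : ℕ → Term C ar) (ρ ξ : ℕ → ℕ),
      (fun n => (upShiftC σ n).rename ρ (liftRen ξ)) =
        upShiftC (fun n => (σ n).rename ρ ξ) := by
    intro σ ρ ξ; funext n
    simp only [upShiftC, shiftC, rename_rename]; rfl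
  induction t generalizing ρ ξ σ τ with
  | appC t l ih => simp only [rename, subst_appC, ih, CTerm.rename_subst]
  | _ => simp_all [rename]

theorem subst_subst (t : Term C ar) (σ σ' : ℕ → Term C ar) (τ τ' : ℕ → CTerm ar) :
    (t.subst σ τ).subst σ' τ' =
      t.subst (fun n => (σ n).subst σ' τ') (fun n => (τ n).subst τ') := by
  have h : ∀ (σ σ' : ℕ → Term C ar) (τ' : ℕ → CTerm ar),
      (fun n => (up σ n).subst (up σ') τ') = up (fun n => (σ n).subst σ' τ') := by
    intro σ σ' τ'; funext n
    cases n
    · rfl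
    · simp only [up, scons, shift, rename_subst, subst_rename, CTerm.rename_eq_subst, id,
        CTerm.subst_ivar]
  have h' : ∀ (τ τ' : ℕ → CTerm ar),
      (fun n => (upC τ n).subst (upC τ')) = upC (fun n => (τ n).subst τ') := by
    intro τ τ'; funext n
    cases n
    · rfl
    · simp only [upC, scons, CTerm.shiftC, CTerm.rename_subst, CTerm.subst_rename]
  have h'' : ∀ (σ σ' : ℕ → Term C ar) (τ' : ℕ → CTerm ar),
      (fun n => (upShiftC σ n).subst (upShiftC σ') (upC τ')) =
        upShiftC (fun n => (σ n).subst σ' τ') := by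
    intro σ σ' τ'; funext n
    simp only [upShiftC, shiftC, rename_subst, subst_rename, upC, scons, id]; rfl
  induction t generalizing σ σ' τ τ' with
  | appC t l ih => simp only [subst_appC, ih, CTerm.subst_subst]
  | _ => simp_all

@[simp]
theorem subst_id (t : Term C ar) : t.subst .var .ivar = t := by
  induction t <;> simp_all

theorem shift_eq_subst (t : Term C ar) :
    t.shift = t.subst (fun n => .var (n + 1)) .ivar := rename_eq_subst t _ _

theorem shiftC_eq_subst (t : Term C ar) :
    t.shiftC = t.subst .var (fun n => .ivar (n + 1)) := rename_eq_subst t _ _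

@[simp]
theorem shift_inst (t u : Term C ar) : t.shift.inst u = t := by
  simp only [inst, shift, subst_rename]; exact subst_id t

@[simp]
theorem shiftC_instC (t : Term C ar) (l : CTerm ar) : t.shiftC.instC l = t := by
  simp only [instC, shiftC, subst_rename]; exact subst_id t

theorem shift_subst (t : Term C ar) (σ : ℕ → Term C ar) (τ : ℕ → CTerm ar) :
    (t.subst σ τ).shift = t.shift.subst (up σ) τ := by
  simp only [shift, rename_subst, subst_rename, CTerm.rename_eq_subst, id, CTerm.subst_ivar]; rfl

theorem shiftC_subst (t : Term C ar) (σ : ℕ → Term C ar) (τ : ℕ → CTerm ar) :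
    (t.subst σ τ).shiftC = t.shiftC.subst (upShiftC σ) (upC τ) := by
  simp only [shiftC, rename_subst, subst_rename]; rfl

theorem inst_subst (t u : Term C ar) (σ : ℕ → Term C ar) (τ : ℕ → CTerm ar) :
    (t.inst u).subst σ τ = (t.subst (up σ) τ).inst (u.subst σ τ) := by
  simp only [inst, subst_subst]
  congr 1
  · funext n
    cases n
    · rfl
    · exact (shift_inst _ _).symm
  · funext n; exact (CTerm.subst_ivar _).symm

theorem instC_subst (t : Term C ar) (l : CTerm ar) (σ : ℕ → Term C ar) (τ : ℕ → CTerm ar) :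
    (t.instC l).subst σ τ = (t.subst (upShiftC σ) (upC τ)).instC (l.subst τ) := by
  simp only [instC, subst_subst]
  congr 1
  · funext n; exact (shiftC_instC _ _).symm
  · funext n
    cases n
    · rfl
    · simp only [upC, scons, CTerm.shiftC, CTerm.subst_rename]
      exact (CTerm.subst_ivar _).symm

/-- The term is unchanged by every substitution. -/
def Closed (t : Term C ar) : Prop := ∀ σ τ, t.subst σ τ = t

end Term

/-! ## Constants of a term -/

theorem CTerm.Over.subst {Q : F → Prop} {l : CTerm ar} (h : l.Over Q) {τ : ℕ → CTerm ar}
    (hτ : ∀ n, (τ n).Over Q) : (l.subst τ).Over Q := by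
  induction l with
  | ivar n => exact hτ n
  | fn f ls ih => exact ⟨h.1, fun k => ih k (h.2 k)⟩

theorem Term.Over.subst {P : C → Prop} {Q : F → Prop} {t : Term C ar} (h : t.Over P Q)
    {σ : ℕ → Term C ar} {τ : ℕ → CTerm ar} (hσ : ∀ n, (σ n).Over P Q) (hτ : ∀ n, (τ n).Over Q) :
    (t.subst σ τ).Over P Q := by
  have hrenC : ∀ (l : CTerm ar) (ξ : ℕ → ℕ), l.Over Q → (l.rename ξ).Over Q := by
    intro l ξ h
    rw [CTerm.rename_eq_subst]
    exact h.subst fun _ => trivial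
  have hren : ∀ (t : Term C ar) (ρ ξ : ℕ → ℕ), t.Over P Q → (t.rename ρ ξ).Over P Q := by
    intro t
    induction t with
    | appC t l ih =>
      intro ρ ξ h
      exact ⟨ih _ _ h.1, hrenC _ _ h.2⟩
    | _ => simp_all [rename, Over]
  induction t generalizing σ τ with
  | var n => exact hσ n
  | const c => exact h
  | sort s => trivial
  | pi A B ihA ihB =>
    refine ⟨ihA h.1 hσ hτ, ihB h.2 (fun n => ?_) hτ⟩
    cases n
    · trivial
    · exact hren _ _ _ (hσ _)
  | abs t ih =>
    refine ih h (fun n => ?_) hτ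
    cases n
    · trivial
    · exact hren _ _ _ (hσ _)
  | app t u iht ihu => exact ⟨iht h.1 hσ hτ, ihu h.2 hσ hτ⟩
  | piC A B ihA ihB =>
    refine ⟨ihA h.1 hσ hτ, ihB h.2 (fun n => hren _ _ _ (hσ n)) (fun n => ?_)⟩
    cases n
    · trivial
    · exact hrenC _ _ (hτ _)
  | absC t ih =>
    refine ih h (fun n => hren _ _ _ (hσ n)) (fun n => ?_)
    cases n
    · trivial
    · exact hrenC _ _ (hτ _)
  | appC t l ih => exact ⟨ih h.1 hσ hτ, h.2.subst hτ⟩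

theorem Term.Over.inst {P : C → Prop} {Q : F → Prop} {t u : Term C ar} (ht : t.Over P Q)
    (hu : u.Over P Q) : (t.inst u).Over P Q :=
  ht.subst (fun n => by cases n; exacts [hu, trivial]) fun _ => trivial

theorem Term.Over.instC {P : C → Prop} {Q : F → Prop} {t : Term C ar} {l : CTerm ar}
    (ht : t.Over P Q) (hl : l.Over Q) : (t.instC l).Over P Q :=
  ht.subst (fun _ => trivial) (fun n => by cases n; exacts [hl, trivial])

theorem CTerm.Over.mono {Q Q' : F → Prop} {l : CTerm ar} (h : l.Over Q) (hQ : ∀ f, Q f → Q' f) :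
    l.Over Q' := by
  induction l with
  | ivar n => trivial
  | fn f ls ih => exact ⟨hQ _ h.1, fun k => ih k (h.2 k)⟩

theorem Term.Over.mono {P P' : C → Prop} {Q Q' : F → Prop} {t : Term C ar} (h : t.Over P Q)
    (hP : ∀ c, P c → P' c) (hQ : ∀ f, Q f → Q' f) : t.Over P' Q' := by
  induction t with
  | appC t l ih => exact ⟨ih h.1, h.2.mono hQ⟩
  | _ => simp_all [Over]

/-! ## Closure properties of reduction and conversion -/

theorem eqvGen_mono {α : Type*} {r r' : α → α → Prop} (h : ∀ a b, r a b → r' a b) {a b : α}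
    (hab : Relation.EqvGen r a b) : Relation.EqvGen r' a b := by
  induction hab with
  | refl a => exact .refl a
  | rel a b hab => exact .rel _ _ (h _ _ hab)
  | symm _ _ _ ih => exact ih.symm
  | trans _ _ _ _ _ ih ih' => exact ih.trans _ _ _ ih'

theorem CompatC.mono {Q Q' : CTerm ar → CTerm ar → Prop} (hQ : ∀ l l', Q l l' → Q' l l')
    {l l' : CTerm ar} (h : CompatC Q l l') : CompatC Q' l l' := by
  induction h with
  | root h => exact .root (hQ _ _ h)
  | fn _ ih => exact .fn ih

theorem CompatC.not_false {l l' : CTerm ar} (h : CompatC (fun _ _ => False) l l') : False := by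
  induction h <;> assumption

theorem CompatC.subst {Q : CTerm ar → CTerm ar → Prop} {τ : ℕ → CTerm ar}
    (hQ : ∀ l l', Q l l' → Q (l.subst τ) (l'.subst τ)) {l l' : CTerm ar} (h : CompatC Q l l') :
    CompatC Q (l.subst τ) (l'.subst τ) := by
  induction h with
  | root h => exact .root (hQ _ _ h)
  | @fn f ls k l' _ ih =>
    have : (fun j => (Function.update ls k l' j).subst τ) =
        Function.update (fun j => (ls j).subst τ) k (l'.subst τ) := by
      funext j
      by_cases hj : j = k
      · subst hj; simp
      · simp [hj]
    simp only [CTerm.subst, this]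
    exact .fn ih

theorem Compat.mono {R R' : Term C ar → Term C ar → Prop} {Q Q' : CTerm ar → CTerm ar → Prop}
    (hR : ∀ t t', R t t' → R' t t') (hQ : ∀ l l', Q l l' → Q' l l') {t t' : Term C ar}
    (h : Compat R Q t t') : Compat R' Q' t t' := by
  induction h with
  | root h => exact .root (hR _ _ h)
  | piL _ ih => exact .piL ih
  | piR _ ih => exact .piR ih
  | abs _ ih => exact .abs ih
  | appL _ ih => exact .appL ih
  | appR _ ih => exact .appR ih
  | piCL _ ih => exact .piCL ih
  | piCR _ ih => exact .piCR ih
  | absC _ ih => exact .absC ih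
  | appCL _ ih => exact .appCL ih
  | appCR h => exact .appCR (h.mono hQ)

theorem Compat.subst {R : Term C ar → Term C ar → Prop} {Q : CTerm ar → CTerm ar → Prop}
    (hR : ∀ t t' σ τ, R t t' → R (t.subst σ τ) (t'.subst σ τ))
    (hQ : ∀ l l' τ, Q l l' → Q (l.subst τ) (l'.subst τ)) {t t' : Term C ar}
    (h : Compat R Q t t') (σ : ℕ → Term C ar) (τ : ℕ → CTerm ar) :
    Compat R Q (t.subst σ τ) (t'.subst σ τ) := by
  induction h generalizing σ τ with
  | root h => exact .root (hR _ _ _ _ h)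
  | piL _ ih => exact .piL (ih _ _)
  | piR _ ih => exact .piR (ih _ _)
  | abs _ ih => exact .abs (ih _ _)
  | appL _ ih => exact .appL (ih _ _)
  | appR _ ih => exact .appR (ih _ _)
  | piCL _ ih => exact .piCL (ih _ _)
  | piCR _ ih => exact .piCR (ih _ _)
  | absC _ ih => exact .absC (ih _ _)
  | appCL _ ih => exact .appCL (ih _ _)
  | appCR h => exact .appCR (h.subst fun _ _ h => hQ _ _ _ h)

/-- A step of a union of root relations is a step of one of them. -/
theorem Compat.or {R R' : Term C ar → Term C ar → Prop} {Q : CTerm ar → CTerm ar → Prop}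
    {t t' : Term C ar} (h : Compat (fun t t' => R t t' ∨ R' t t') Q t t') :
    Compat R Q t t' ∨ Compat R' Q t t' := by
  induction h with
  | root h => exact h.imp .root .root
  | piL _ ih => exact ih.imp .piL .piL
  | piR _ ih => exact ih.imp .piR .piR
  | abs _ ih => exact ih.imp .abs .abs
  | appL _ ih => exact ih.imp .appL .appL
  | appR _ ih => exact ih.imp .appR .appR
  | piCL _ ih => exact ih.imp .piCL .piCL
  | piCR _ ih => exact ih.imp .piCR .piCR
  | absC _ ih => exact ih.imp .absC .absC
  | appCL _ ih => exact ih.imp .appCL .appCL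
  | appCR h => exact .inl (.appCR h)

/-- A step of a relation on terms or of one on confined terms is a step of one of them. -/
theorem Compat.split {R : Term C ar → Term C ar → Prop} {Q : CTerm ar → CTerm ar → Prop}
    {t t' : Term C ar} (h : Compat R Q t t') :
    CtxClosure R t t' ∨ Compat (fun _ _ => False) Q t t' := by
  induction h with
  | root h => exact .inl (.root h)
  | piL _ ih => exact ih.imp .piL .piL
  | piR _ ih => exact ih.imp .piR .piR
  | abs _ ih => exact ih.imp .abs .abs
  | appL _ ih => exact ih.imp .appL .appL
  | appR _ ih => exact ih.imp .appR .appR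
  | piCL _ ih => exact ih.imp .piCL .piCL
  | piCR _ ih => exact ih.imp .piCR .piCR
  | absC _ ih => exact ih.imp .absC .absC
  | appCL _ ih => exact ih.imp .appCL .appCL
  | appCR h => exact .inr (.appCR h)

-- Conversion as the equivalence generated by a single compatible relation.

namespace Theory

variable {T : Theory C ar}

/-- The union of the root relations of one-step reduction. -/
def RootStep (T : Theory C ar) (t t' : Term C ar) : Prop :=
  BetaRoot t t' ∨ BetaCRoot t t' ∨ T.RuleRoot t t' ∨ T.DeltaRoot t t'

theorem step_iff {t t' : Term C ar} : T.Step t t' ↔ CtxClosure T.RootStep t t' := by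
  constructor
  · have hF : ∀ l l' : CTerm ar, False → False := fun _ _ h => h
    rintro (h | h | h | h)
    · exact h.mono (fun _ _ => .inl) hF
    · exact h.mono (fun _ _ h => .inr (.inl h)) hF
    · exact h.mono (fun _ _ h => .inr (.inr (.inl h))) hF
    · exact h.mono (fun _ _ h => .inr (.inr (.inr h))) hF
  · exact fun h => h.or.imp_right fun h => h.or.imp_right fun h => h.or

/-- One step of reduction or of an equation between terms of the theory. -/
def ConvStep (T : Theory C ar) (t u : Term C ar) : Prop :=
  t.OverSig T.sig ∧ u.OverSig T.sig ∧ Compat T.RootStep T.EqRoot t u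

/-- The relation `≃` inside conversion is itself an equivalence closure. Flattening the two closures
leaves a single generating step, so every later induction on conversion has one base case. -/
theorem conv_iff {t u : Term C ar} : T.Conv t u ↔ Relation.EqvGen T.ConvStep t u := by
  constructor
  · intro h
    induction h with
    | refl t => exact .refl t
    | symm _ _ _ ih => exact ih.symm
    | trans _ _ _ _ _ ih ih' => exact ih.trans _ _ _ ih'
    | rel t u h =>
      obtain ⟨ht, hu, h | h⟩ := h
      · exact .rel _ _ ⟨ht, hu, (step_iff.1 h).mono (fun _ _ h => h) (fun _ _ h => h.elim)⟩
      · exact eqvGen_mono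
          (fun _ _ h => ⟨h.1, h.2.1, h.2.2.mono (fun _ _ h => h.elim) (fun _ _ h => h)⟩) h
  · refine eqvGen_mono fun t u h => ⟨h.1, h.2.1, ?_⟩
    exact h.2.2.split.imp step_iff.2 fun h' => .rel _ _ ⟨h.1, h.2.1, h'⟩

namespace Conv

theorem refl (t : Term C ar) : T.Conv t t := Relation.EqvGen.refl t

theorem symm {t u : Term C ar} (h : T.Conv t u) : T.Conv u t := Relation.EqvGen.symm _ _ h

theorem trans {t u w : Term C ar} (h : T.Conv t u) (h' : T.Conv u w) : T.Conv t w :=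
  Relation.EqvGen.trans _ _ _ h h'

theorem of_rootStep {t u : Term C ar} (ht : t.OverSig T.sig) (hu : u.OverSig T.sig)
    (h : T.RootStep t u) : T.Conv t u :=
  conv_iff.2 (.rel _ _ ⟨ht, hu, .root h⟩)

theorem of_step {t u : Term C ar} (ht : t.OverSig T.sig) (hu : u.OverSig T.sig)
    (h : CtxClosure T.RootStep t u) : T.Conv t u :=
  .rel _ _ ⟨ht, hu, .inl (step_iff.2 h)⟩

theorem map (f : Term C ar → Term C ar) (hf : ∀ t, t.OverSig T.sig → (f t).OverSig T.sig)
    (hf' : ∀ t u, Compat T.RootStep T.EqRoot t u → Compat T.RootStep T.EqRoot (f t) (f u))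
    {t u : Term C ar} (h : T.Conv t u) : T.Conv (f t) (f u) := by
  rw [conv_iff] at h ⊢
  induction h with
  | refl t => exact .refl _
  | rel t u h => exact .rel _ _ ⟨hf _ h.1, hf _ h.2.1, hf' _ _ h.2.2⟩
  | symm _ _ _ ih => exact ih.symm
  | trans _ _ _ _ _ ih ih' => exact ih.trans _ _ _ ih'

variable {A A' B B' t t' u u' : Term C ar}

/-- The path changes one component at a time, and the component held fixed must lie over the
signature. This has to be assumed, because conversion is reflexive on arbitrary terms. -/
theorem pi (h : T.Conv A A') (h' : T.Conv B B') (hA : A'.OverSig T.sig) (hB : B.OverSig T.sig) :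
    T.Conv (.pi A B) (.pi A' B') :=
  (map (Term.pi · B) (fun _ h => ⟨h, hB⟩) (fun _ _ => .piL) h).trans
    (map (Term.pi A') (fun _ h => ⟨hA, h⟩) (fun _ _ => .piR) h')

theorem piC (h : T.Conv A A') (h' : T.Conv B B') (hA : A'.OverSig T.sig) (hB : B.OverSig T.sig) :
    T.Conv (.piC A B) (.piC A' B') :=
  (map (Term.piC · B) (fun _ h => ⟨h, hB⟩) (fun _ _ => .piCL) h).trans
    (map (Term.piC A') (fun _ h => ⟨hA, h⟩) (fun _ _ => .piCR) h')

theorem app (h : T.Conv t t') (h' : T.Conv u u') (ht : t'.OverSig T.sig) (hu : u.OverSig T.sig) :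
    T.Conv (.app t u) (.app t' u') :=
  (map (Term.app · u) (fun _ h => ⟨h, hu⟩) (fun _ _ => .appL) h).trans
    (map (Term.app t') (fun _ h => ⟨ht, h⟩) (fun _ _ => .appR) h')

theorem abs (h : T.Conv t t') : T.Conv (.abs t) (.abs t') :=
  map Term.abs (fun _ h => h) (fun _ _ => .abs) h

theorem absC (h : T.Conv t t') : T.Conv (.absC t) (.absC t') :=
  map Term.absC (fun _ h => h) (fun _ _ => .absC) h

theorem appC_left (h : T.Conv t t') {l : CTerm ar} (hl : l.Over (DeclaredInC T.sig)) :
    T.Conv (.appC t l) (.appC t' l) :=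
  map (Term.appC · l) (fun _ h => ⟨h, hl⟩) (fun _ _ => .appCL) h

theorem appC_right {l l' : CTerm ar} (h : Relation.EqvGen (CompatC T.EqRoot) l l')
    (ht : t.OverSig T.sig) (hT : ∀ l : CTerm ar, l.Over (DeclaredInC T.sig)) :
    T.Conv (.appC t l) (.appC t l') := by
  rw [conv_iff]
  induction h with
  | refl t => exact .refl _
  | rel l l' h => exact .rel _ _ ⟨⟨ht, hT _⟩, ⟨ht, hT _⟩, .appCR h⟩
  | symm _ _ _ ih => exact ih.symm
  | trans _ _ _ _ _ ih ih' => exact ih.trans _ _ _ ih'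

end Conv

theorem EqRoot.subst {l l' : CTerm ar} (h : T.EqRoot l l') (τ : ℕ → CTerm ar) :
    T.EqRoot (l.subst τ) (l'.subst τ) := by
  obtain ⟨he, τ'⟩ := h
  simp only [CTerm.subst_subst]
  exact .mk he _

/-- The bodies of the definitions are closed. -/
def ClosedBodies (T : Theory C ar) : Prop := ∀ c A t, Decl.defn c A t ∈ T.sig → t.Closed

/-- Only `δ` needs the hypothesis: a constant is untouched by substitution, so its body must be as
well. -/
theorem RootStep.subst (hT : T.ClosedBodies) {t t' : Term C ar} (h : T.RootStep t t')
    (σ : ℕ → Term C ar) (τ : ℕ → CTerm ar) : T.RootStep (t.subst σ τ) (t'.subst σ τ) := by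
  rcases h with ⟨t, u⟩ | ⟨t, l⟩ | ⟨hr, σ', τ'⟩ | @⟨c, A, t, h⟩
  · rw [Term.inst_subst]; exact .inl (.mk _ _)
  · rw [Term.instC_subst]; exact .inr (.inl (.mk _ _))
  · simp only [Term.subst_subst]; exact .inr (.inr (.inl (.mk hr _ _)))
  · rw [hT _ _ _ h]; exact .inr (.inr (.inr (.mk h)))

theorem Conv.subst (hT : T.ClosedBodies) {t t' : Term C ar} (h : T.Conv t t')
    {σ : ℕ → Term C ar} {τ : ℕ → CTerm ar} (hσ : ∀ n, (σ n).OverSig T.sig)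
    (hτ : ∀ n, (τ n).Over (DeclaredInC T.sig)) : T.Conv (t.subst σ τ) (t'.subst σ τ) :=
  h.map (Term.subst σ τ) (fun _ h => h.subst hσ hτ)
    fun _ _ h => h.subst (fun _ _ _ _ h => h.subst hT _ _) (fun _ _ _ h => h.subst _) _ _

theorem Conv.inst (hT : T.ClosedBodies) {t t' : Term C ar} (h : T.Conv t t') {u : Term C ar}
    (hu : u.OverSig T.sig) : T.Conv (t.inst u) (t'.inst u) :=
  h.subst hT (fun n => by cases n; exacts [hu, trivial]) fun _ => trivial

theorem Conv.instC (hT : T.ClosedBodies) {t t' : Term C ar} (h : T.Conv t t') {l : CTerm ar}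
    (hl : l.Over (DeclaredInC T.sig)) : T.Conv (t.instC l) (t'.instC l) :=
  h.subst hT (fun _ => trivial) fun n => by cases n; exacts [hl, trivial]

theorem Conv.shift (hT : T.ClosedBodies) {t t' : Term C ar} (h : T.Conv t t') :
    T.Conv t.shift t'.shift := by
  simp only [Term.shift_eq_subst]
  exact h.subst hT (fun _ => trivial) fun _ => trivial

/-- Substituting convertible terms gives convertible terms. -/
theorem Conv.subst_right (hT : T.ClosedBodies) {t : Term C ar} (ht : t.OverSig T.sig)
    {σ σ' : ℕ → Term C ar} {τ : ℕ → CTerm ar} (hσ : ∀ n, (σ n).OverSig T.sig)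
    (hσ' : ∀ n, (σ' n).OverSig T.sig) (hτ : ∀ n, (τ n).Over (DeclaredInC T.sig))
    (h : ∀ n, T.Conv (σ n) (σ' n)) : T.Conv (t.subst σ τ) (t.subst σ' τ) := by
  have hup : ∀ σ : ℕ → Term C ar, (∀ n, (σ n).OverSig T.sig) → ∀ n, (up σ n).OverSig T.sig := by
    intro σ hσ n
    cases n
    · trivial
    · simp only [up, scons, Term.shift_eq_subst]
      exact (hσ _).subst (fun _ => trivial) fun _ => trivial
  have hupS : ∀ σ : ℕ → Term C ar, (∀ n, (σ n).OverSig T.sig) →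
      ∀ n, (upShiftC σ n).OverSig T.sig := by
    intro σ hσ n
    simp only [upShiftC, Term.shiftC_eq_subst]
    exact (hσ _).subst (fun _ => trivial) fun _ => trivial
  have hupC : ∀ τ : ℕ → CTerm ar, (∀ n, (τ n).Over (DeclaredInC T.sig)) →
      ∀ n, (upC τ n).Over (DeclaredInC T.sig) := by
    intro τ hτ n
    cases n
    · trivial
    · simp only [upC, scons, CTerm.shiftC, CTerm.rename_eq_subst]
      exact (hτ _).subst fun _ => trivial
  have hupR : ∀ σ σ' : ℕ → Term C ar, (∀ n, T.Conv (σ n) (σ' n)) →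
      ∀ n, T.Conv (up σ n) (up σ' n) := by
    intro σ σ' h n
    cases n
    · exact .refl _
    · exact (h _).shift hT
  have hupSR : ∀ σ σ' : ℕ → Term C ar, (∀ n, T.Conv (σ n) (σ' n)) →
      ∀ n, T.Conv (upShiftC σ n) (upShiftC σ' n) := by
    intro σ σ' h n
    simp only [upShiftC, Term.shiftC_eq_subst]
    exact (h _).subst hT (fun _ => trivial) fun _ => trivial
  induction t generalizing σ σ' τ with
  | var n => exact h n
  | const c => exact .refl _
  | sort s => exact .refl _
  | pi A B ihA ihB =>
    exact (ihA ht.1 hσ hσ' hτ h).pi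
      (ihB ht.2 (hup _ hσ) (hup _ hσ') hτ (hupR _ _ h))
      (ht.1.subst hσ' hτ) (ht.2.subst (hup _ hσ) hτ)
  | abs t ih => exact (ih ht (hup _ hσ) (hup _ hσ') hτ (hupR _ _ h)).abs
  | app t u iht ihu =>
    exact (iht ht.1 hσ hσ' hτ h).app (ihu ht.2 hσ hσ' hτ h) (ht.1.subst hσ' hτ) (ht.2.subst hσ hτ)
  | piC A B ihA ihB =>
    exact (ihA ht.1 hσ hσ' hτ h).piC
      (ihB ht.2 (hupS _ hσ) (hupS _ hσ') (hupC _ hτ) (hupSR _ _ h))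
      (ht.1.subst hσ' hτ) (ht.2.subst (hupS _ hσ) (hupC _ hτ))
  | absC t ih => exact (ih ht (hupS _ hσ) (hupS _ hσ') (hupC _ hτ) (hupSR _ _ h)).absC
  | appC t l ih => exact (ih ht.1 hσ hσ' hτ h).appC_left (ht.2.subst hτ)

theorem Conv.inst_right (hT : T.ClosedBodies) {t u u' : Term C ar} (ht : t.OverSig T.sig)
    (hu : u.OverSig T.sig) (hu' : u'.OverSig T.sig) (h : T.Conv u u') :
    T.Conv (t.inst u) (t.inst u') :=
  .subst_right hT ht (fun n => by cases n; exacts [hu, trivial])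
    (fun n => by cases n; exacts [hu', trivial]) (fun _ => trivial)
    fun n => by cases n; exacts [h, .refl _]

/-- The inclusion of theories. -/
structure Sub (T T' : Theory C ar) : Prop where
  sig : ∀ d ∈ T.sig, d ∈ T'.sig
  rules : T.rules ⊆ T'.rules
  eqs : T.eqs ⊆ T'.eqs

theorem Sub.overSig {T T' : Theory C ar} (h : T.Sub T') {t : Term C ar} (ht : t.OverSig T.sig) :
    t.OverSig T'.sig :=
  ht.mono (fun _ => List.map_subset _ h.sig (a := _)) fun _ => List.map_subset _ h.sig (a := _)

theorem Sub.conv {T T' : Theory C ar} (h : T.Sub T') {t u : Term C ar} (htu : T.Conv t u) :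
    T'.Conv t u := by
  rw [conv_iff] at htu ⊢
  refine eqvGen_mono (fun t u ⟨ht, hu, htu⟩ => ⟨h.overSig ht, h.overSig hu, htu.mono ?_ ?_⟩) htu
  · rintro _ _ (h' | h' | ⟨hr, σ, τ⟩ | @⟨c, A, t, h'⟩)
    · exact .inl h'
    · exact .inr (.inl h')
    · exact .inr (.inr (.inl (.mk (h.rules hr) _ _)))
    · exact .inr (.inr (.inr (.mk (h.sig _ h'))))
  · rintro _ _ ⟨he, τ⟩
    exact .mk (h.eqs he) _

end Theory

variable {T : Theory C ar}

/-! ## Basic properties of typing -/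

/-- Simultaneous induction on the three typing judgments. -/
theorem typing_induction {W : Ctx C ar → Prop} {P : Ctx C ar → Term C ar → Term C ar → Prop}
    {Q : Ctx C ar → CTerm ar → Term C ar → Prop}
    (empty : W [])
    (ext : ∀ {Γ A}, HasType T Γ A (.sort .type) → P Γ A (.sort .type) → W (.reg A :: Γ))
    (extC : ∀ {Γ A}, HasType T Γ A (.sort .type) → P Γ A (.sort .type) → W (.conf A :: Γ))
    (sort : ∀ {Γ}, WfCtx T Γ → W Γ → P Γ (.sort .type) (.sort .kind))
    (var : ∀ {Γ n A}, WfCtx T Γ → W Γ → LookupVar Γ n A → P Γ (.var n) A)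
    (const : ∀ {Γ c A}, WfCtx T Γ → W Γ → Decl.const c A ∈ T.sig → P Γ (.const c) A)
    (defn : ∀ {Γ c A u}, WfCtx T Γ → W Γ → Decl.defn c A u ∈ T.sig → P Γ (.const c) A)
    (conv : ∀ {Γ t A B s}, HasType T Γ t A → P Γ t A → HasType T Γ B (.sort s) →
      P Γ B (.sort s) → T.Conv A B → P Γ t B)
    (pi : ∀ {Γ A B s}, HasType T Γ A (.sort .type) → P Γ A (.sort .type) →
      HasType T (.reg A :: Γ) B (.sort s) → P (.reg A :: Γ) B (.sort s) →
      P Γ (.pi A B) (.sort s))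
    (piC : ∀ {Γ A B s}, HasType T Γ A (.sort .type) → P Γ A (.sort .type) →
      HasType T (.conf A :: Γ) B (.sort s) → P (.conf A :: Γ) B (.sort s) →
      P Γ (.piC A B) (.sort s))
    (abs : ∀ {Γ A B t s}, HasType T Γ A (.sort .type) → P Γ A (.sort .type) →
      HasType T (.reg A :: Γ) B (.sort s) → P (.reg A :: Γ) B (.sort s) →
      HasType T (.reg A :: Γ) t B → P (.reg A :: Γ) t B → P Γ (.abs t) (.pi A B))
    (absC : ∀ {Γ A B t s}, HasType T Γ A (.sort .type) → P Γ A (.sort .type) →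
      HasType T (.conf A :: Γ) B (.sort s) → P (.conf A :: Γ) B (.sort s) →
      HasType T (.conf A :: Γ) t B → P (.conf A :: Γ) t B → P Γ (.absC t) (.piC A B))
    (app : ∀ {Γ A B t u}, HasType T Γ t (.pi A B) → P Γ t (.pi A B) → HasType T Γ u A →
      P Γ u A → P Γ (.app t u) (B.inst u))
    (appC : ∀ {Γ A B t l}, HasType T Γ t (.piC A B) → P Γ t (.piC A B) → HasTypeC T Γ l A →
      Q Γ l A → P Γ (.appC t l) (B.instC l))
    (ivar : ∀ {Γ n A}, WfCtx T Γ → W Γ → LookupVarC Γ n A → Q Γ (.ivar n) A)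
    (fn : ∀ {Γ f Δ A} {ls : Fin (ar f) → CTerm ar}, WfCtx T Γ → W Γ → Decl.conf f Δ A ∈ T.sig →
      (∀ k : Fin (ar f), HasTypeC T Γ (ls k) ((Δ k).subst .var (prefixSubst ls k k.isLt.le))) →
      (∀ k : Fin (ar f), Q Γ (ls k) ((Δ k).subst .var (prefixSubst ls k k.isLt.le))) →
      Q Γ (.fn f ls) (A.subst .var (prefixSubst ls (ar f) le_rfl)))
    (convC : ∀ {Γ l A B}, HasTypeC T Γ l A → Q Γ l A → HasType T Γ B (.sort .type) →
      P Γ B (.sort .type) → T.Conv A B → Q Γ l B) :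
    (∀ {Γ}, WfCtx T Γ → W Γ) ∧ (∀ {Γ t A}, HasType T Γ t A → P Γ t A) ∧
      (∀ {Γ l A}, HasTypeC T Γ l A → Q Γ l A) := by
  refine ⟨fun {Γ} h => WfCtx.rec (motive_1 := fun Γ _ => W Γ) (motive_2 := fun Γ t A _ => P Γ t A)
      (motive_3 := fun Γ t A _ => Q Γ t A) ?_ ?_ ?_ ?_ ?_ ?_ ?_ ?_ ?_ ?_ ?_ ?_ ?_ ?_ ?_ ?_ ?_ h,
    fun {Γ t A} h => HasType.rec (motive_1 := fun Γ _ => W Γ) (motive_2 := fun Γ t A _ => P Γ t A)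
      (motive_3 := fun Γ t A _ => Q Γ t A) ?_ ?_ ?_ ?_ ?_ ?_ ?_ ?_ ?_ ?_ ?_ ?_ ?_ ?_ ?_ ?_ ?_ h,
    fun {Γ t A} h => HasTypeC.rec (motive_1 := fun Γ _ => W Γ) (motive_2 := fun Γ t A _ => P Γ t A)
      (motive_3 := fun Γ t A _ => Q Γ t A) ?_ ?_ ?_ ?_ ?_ ?_ ?_ ?_ ?_ ?_ ?_ ?_ ?_ ?_ ?_ ?_ ?_ h⟩
  all_goals
    intros
    first
      | exact empty
      | (apply ext <;> assumption)
      | (apply extC <;> assumption)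
      | (apply sort <;> assumption)
      | (apply var <;> assumption)
      | (apply const <;> assumption)
      | (apply defn <;> assumption)
      | (apply conv <;> assumption)
      | (apply pi <;> assumption)
      | (apply piC <;> assumption)
      | (apply abs <;> assumption)
      | (apply absC <;> assumption)
      | (apply app <;> assumption)
      | (apply appC <;> assumption)
      | (apply ivar <;> assumption)
      | (apply fn <;> assumption)
      | (apply convC <;> assumption)

theorem HasType.wfCtx {Γ : Ctx C ar} {t A : Term C ar} (h : HasType T Γ t A) : WfCtx T Γ := by
  refine (typing_induction (T := T) (W := fun _ => True) (P := fun Γ _ _ => WfCtx T Γ)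
    (Q := fun _ _ _ => True) ?_ ?_ ?_ ?_ ?_ ?_ ?_ ?_ ?_ ?_ ?_ ?_ ?_ ?_ ?_ ?_ ?_).2.1 h
  all_goals intros; trivial

theorem HasType.mono {T' : Theory C ar} (hT : T.Sub T') {Γ : Ctx C ar} {t A : Term C ar}
    (h : HasType T Γ t A) : HasType T' Γ t A := by
  refine (typing_induction (T := T) (W := WfCtx T') (P := HasType T') (Q := HasTypeC T')
    ?_ ?_ ?_ ?_ ?_ ?_ ?_ ?_ ?_ ?_ ?_ ?_ ?_ ?_ ?_ ?_ ?_).2.1 h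
  · exact .empty
  · exact fun _ => .ext
  · exact fun _ => .extC
  · exact fun _ => .sort
  · exact fun _ => .var
  · exact fun _ h h' => .const h (hT.sig _ h')
  · exact fun _ h h' => .defn h (hT.sig _ h')
  · exact fun _ h _ h' hc => .conv h h' (hT.conv hc)
  · exact fun _ h _ h' => .pi h h'
  · exact fun _ h _ h' => .piC h h'
  · exact fun _ h _ h' _ h'' => .abs h h' h''
  · exact fun _ h _ h' _ h'' => .absC h h' h''
  · exact fun _ h _ h' => .app h h'
  · exact fun _ h _ h' => .appC h h'
  · exact fun _ => .ivar
  · exact fun _ h h' _ hl => .fn h (hT.sig _ h') hl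
  · exact fun _ h _ h' hc => .conv h h' (hT.conv hc)

/-- Conversion is defined on terms over the signature only. This lemma discharges the resulting side
conditions whenever the terms involved are typed. -/
theorem typing_overSig :
    (∀ {Γ}, WfCtx T Γ → True) ∧ (∀ {Γ t A}, HasType T Γ t A → t.OverSig T.sig) ∧
      (∀ {Γ l A}, HasTypeC T Γ l A → l.Over (DeclaredInC T.sig)) := by
  refine typing_induction (T := T) (W := fun _ => True) (P := fun _ t _ => t.OverSig T.sig)
    (Q := fun _ l _ => l.Over (DeclaredInC T.sig))
    ?_ ?_ ?_ ?_ ?_ ?_ ?_ ?_ ?_ ?_ ?_ ?_ ?_ ?_ ?_ ?_ ?_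
  iterate 5 intros; trivial
  · exact fun _ _ h => List.mem_map_of_mem (f := Decl.name) h
  · exact fun _ _ h => List.mem_map_of_mem (f := Decl.name) h
  · exact fun _ h _ _ _ => h
  · exact fun _ h _ h' => ⟨h, h'⟩
  · exact fun _ h _ h' => ⟨h, h'⟩
  · exact fun _ _ _ _ _ h => h
  · exact fun _ _ _ _ _ h => h
  · exact fun _ h _ h' => ⟨h, h'⟩
  · exact fun _ h _ h' => ⟨h, h'⟩
  · intros; trivial
  · exact fun _ _ h _ h' => ⟨List.mem_map_of_mem (f := Decl.name) h, h'⟩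
  · exact fun _ h _ _ _ => h

theorem HasType.overSig {Γ : Ctx C ar} {t A : Term C ar} (h : HasType T Γ t A) :
    t.OverSig T.sig := typing_overSig.2.1 h

theorem HasTypeC.over {Γ : Ctx C ar} {l : CTerm ar} {A : Term C ar} (h : HasTypeC T Γ l A) :
    l.Over (DeclaredInC T.sig) := typing_overSig.2.2 h

/-- Two substitutions agree on the variables of a context. -/
def AgreeOn (Γ : Ctx C ar) (σ σ' : ℕ → Term C ar) (τ τ' : ℕ → CTerm ar) : Prop :=
  (∀ n A, LookupVar Γ n A → σ n = σ' n) ∧ ∀ n A, LookupVarC Γ n A → τ n = τ' n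

theorem AgreeOn.up {Γ : Ctx C ar} {σ σ' : ℕ → Term C ar} {τ τ' : ℕ → CTerm ar}
    (h : AgreeOn Γ σ σ' τ τ') (A : Term C ar) :
    AgreeOn (.reg A :: Γ) (up σ) (up σ') τ τ' := by
  constructor
  · rintro _ _ (_ | h' | _)
    · rfl
    · simp only [Dedukti.up, scons, h.1 _ _ h']
  · rintro _ _ (_ | h' | _)
    exact h.2 _ _ h'

theorem AgreeOn.upC {Γ : Ctx C ar} {σ σ' : ℕ → Term C ar} {τ τ' : ℕ → CTerm ar}
    (h : AgreeOn Γ σ σ' τ τ') (A : Term C ar) :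
    AgreeOn (.conf A :: Γ) (upShiftC σ) (upShiftC σ') (upC τ) (upC τ') := by
  constructor
  · rintro _ _ (_ | _ | h')
    simp only [upShiftC, h.1 _ _ h']
  · rintro _ _ (_ | _ | h')
    · rfl
    · simp only [Dedukti.upC, scons, h.2 _ _ h']

/-- Typing bounds the free variables by the context. In the empty context all substitutions act
alike, hence like the identity; this is how declared types and bodies of definitions are seen to be
closed. -/
theorem HasType.subst_congr {Γ : Ctx C ar} {t A : Term C ar} (h : HasType T Γ t A) :
    ∀ σ σ' τ τ', AgreeOn Γ σ σ' τ τ' → t.subst σ τ = t.subst σ' τ' := by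
  refine (typing_induction (T := T) (W := fun _ => True)
    (P := fun Γ t _ => ∀ σ σ' τ τ', AgreeOn Γ σ σ' τ τ' → t.subst σ τ = t.subst σ' τ')
    (Q := fun Γ l _ => ∀ σ σ' τ τ', AgreeOn Γ σ σ' τ τ' → l.subst τ = l.subst τ')
    ?_ ?_ ?_ ?_ ?_ ?_ ?_ ?_ ?_ ?_ ?_ ?_ ?_ ?_ ?_ ?_ ?_).2.1 h
  iterate 3 intros; trivial
  · intros; rfl
  · exact fun _ _ h _ _ _ _ h' => h'.1 _ _ h
  · intros; rfl
  · intros; rfl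
  · exact fun _ h _ _ _ => h
  · exact fun _ h _ h' _ _ _ _ ha =>
      congr_arg₂ Term.pi (h _ _ _ _ ha) (h' _ _ _ _ (ha.up _))
  · exact fun _ h _ h' _ _ _ _ ha =>
      congr_arg₂ Term.piC (h _ _ _ _ ha) (h' _ _ _ _ (ha.upC _))
  · exact fun _ _ _ _ _ h _ _ _ _ ha => congr_arg Term.abs (h _ _ _ _ (ha.up _))
  · exact fun _ _ _ _ _ h _ _ _ _ ha => congr_arg Term.absC (h _ _ _ _ (ha.upC _))
  · exact fun _ h _ h' _ _ _ _ ha => congr_arg₂ Term.app (h _ _ _ _ ha) (h' _ _ _ _ ha)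
  · exact fun _ h _ h' _ _ _ _ ha => congr_arg₂ Term.appC (h _ _ _ _ ha) (h' _ _ _ _ ha)
  · exact fun _ _ h _ _ _ _ h' => h'.2 _ _ h
  · exact fun _ _ _ _ h _ _ _ _ ha => congr_arg (CTerm.fn _) (funext fun k => h k _ _ _ _ ha)
  · exact fun _ h _ _ _ => h

theorem HasType.closed {t A : Term C ar} (h : HasType T [] t A) : t.Closed := fun σ τ =>
  (h.subst_congr σ .var τ .ivar ⟨fun _ _ h => (nomatch h), fun _ _ h => (nomatch h)⟩).trans
    t.subst_id

/-! ## Theories with well-typed signatures -/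

/-- The constant `c` is declared with type `A`, with or without a definition. -/
def Declares (T : Theory C ar) (c : C) (A : Term C ar) : Prop :=
  Decl.const c A ∈ T.sig ∨ ∃ t, Decl.defn c A t ∈ T.sig

/-- The term is `Kind`, or is typed by a sort. -/
def IsType (T : Theory C ar) (Γ : Ctx C ar) (A : Term C ar) : Prop :=
  A = .sort .kind ∨ ∃ s, HasType T Γ A (.sort s)

/-- All entries of the signature are well-typed, and the arguments and results of each confined
constant have one and the same type, which is a constant. -/
structure WellTyped (T : Theory C ar) : Prop where
  isType : ∀ c A, Declares T c A → IsType T [] A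
  defn : ∀ c A t, Decl.defn c A t ∈ T.sig → HasType T [] t A
  conf : ∀ f Δ A, Decl.conf f Δ A ∈ T.sig →
    ∃ c, Decl.const c (.sort .type) ∈ T.sig ∧ A = .const c ∧ ∀ k, Δ k = .const c

namespace WellTyped

theorem closedBodies (hT : WellTyped T) : T.ClosedBodies := fun _ _ _ h => (hT.defn _ _ _ h).closed

theorem closed (hT : WellTyped T) {c : C} {A : Term C ar} (h : Declares T c A) : A.Closed := by
  rcases hT.isType _ _ h with rfl | ⟨s, h⟩
  · exact fun _ _ => rfl
  · exact h.closed

end WellTyped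

/-! ## Substitution -/

/-- `σ, τ` is a well-typed substitution from `Γ` to `Δ`. -/
structure TypedSubst (T : Theory C ar) (Δ : Ctx C ar) (σ : ℕ → Term C ar) (τ : ℕ → CTerm ar)
    (Γ : Ctx C ar) : Prop where
  wf : WfCtx T Δ
  var : ∀ n A, LookupVar Γ n A → HasType T Δ (σ n) (A.subst σ τ)
  ivar : ∀ n A, LookupVarC Γ n A → HasTypeC T Δ (τ n) (A.subst σ τ)
  overSig : ∀ n, (σ n).OverSig T.sig
  overSigC : ∀ n, (τ n).Over (DeclaredInC T.sig)

/-- Typing is preserved by every class of well-typed substitutions that is closed under lifting. -/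
theorem typing_subst_of_class (hT : WellTyped T)
    {S : Ctx C ar → (ℕ → Term C ar) → (ℕ → CTerm ar) → Ctx C ar → Prop}
    (hS : ∀ {Δ σ τ Γ}, S Δ σ τ Γ → TypedSubst T Δ σ τ Γ)
    (hup : ∀ {Δ σ τ Γ A}, S Δ σ τ Γ → HasType T Δ (A.subst σ τ) (.sort .type) →
      S (.reg (A.subst σ τ) :: Δ) (up σ) τ (.reg A :: Γ))
    (hupC : ∀ {Δ σ τ Γ A}, S Δ σ τ Γ → HasType T Δ (A.subst σ τ) (.sort .type) →
      S (.conf (A.subst σ τ) :: Δ) (upShiftC σ) (upC τ) (.conf A :: Γ)) :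
    (∀ {Γ}, WfCtx T Γ → True) ∧
      (∀ {Γ t A}, HasType T Γ t A → ∀ Δ σ τ, S Δ σ τ Γ →
        HasType T Δ (t.subst σ τ) (A.subst σ τ)) ∧
      (∀ {Γ l A}, HasTypeC T Γ l A → ∀ Δ σ τ, S Δ σ τ Γ →
        HasTypeC T Δ (l.subst τ) (A.subst σ τ)) := by
  -- The intermediate terms of a conversion may have variables outside `Γ`; this is why a typed
  -- substitution must lie over the signature at every index.
  have hconv : ∀ {Δ σ τ Γ} {A B : Term C ar}, S Δ σ τ Γ → T.Conv A B →
      T.Conv (A.subst σ τ) (B.subst σ τ) := fun hs h =>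
    h.subst hT.closedBodies (hS hs).overSig (hS hs).overSigC
  refine typing_induction (T := T) (W := fun _ => True)
    (P := fun Γ t A => ∀ Δ σ τ, S Δ σ τ Γ → HasType T Δ (t.subst σ τ) (A.subst σ τ))
    (Q := fun Γ l A => ∀ Δ σ τ, S Δ σ τ Γ → HasTypeC T Δ (l.subst τ) (A.subst σ τ))
    ?_ ?_ ?_ ?_ ?_ ?_ ?_ ?_ ?_ ?_ ?_ ?_ ?_ ?_ ?_ ?_ ?_
  iterate 3 intros; trivial
  · exact fun _ _ Δ σ τ hs => .sort (hS hs).wf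
  · exact fun _ _ h Δ σ τ hs => (hS hs).var _ _ h
  · intro _ _ _ _ _ h Δ σ τ hs
    rw [hT.closed (.inl h)]
    exact .const (hS hs).wf h
  · intro _ _ _ _ _ _ h Δ σ τ hs
    rw [hT.closed (.inr ⟨_, h⟩)]
    exact .defn (hS hs).wf h
  · exact fun _ h _ h' hc Δ σ τ hs => .conv (h _ _ _ hs) (h' _ _ _ hs) (hconv hs hc)
  · exact fun _ h _ h' Δ σ τ hs =>
      .pi (h _ _ _ hs) (h' _ _ _ (hup hs (h _ _ _ hs)))
  · exact fun _ h _ h' Δ σ τ hs =>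
      .piC (h _ _ _ hs) (h' _ _ _ (hupC hs (h _ _ _ hs)))
  · exact fun _ h _ h' _ h'' Δ σ τ hs =>
      .abs (h _ _ _ hs) (h' _ _ _ (hup hs (h _ _ _ hs))) (h'' _ _ _ (hup hs (h _ _ _ hs)))
  · exact fun _ h _ h' _ h'' Δ σ τ hs =>
      .absC (h _ _ _ hs) (h' _ _ _ (hupC hs (h _ _ _ hs))) (h'' _ _ _ (hupC hs (h _ _ _ hs)))
  · intro _ _ _ _ _ _ h _ h' Δ σ τ hs
    rw [Term.inst_subst]
    exact .app (h _ _ _ hs) (h' _ _ _ hs)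
  · intro _ _ _ _ _ _ h _ h' Δ σ τ hs
    rw [Term.instC_subst]
    exact .appC (h _ _ _ hs) (h' _ _ _ hs)
  · exact fun _ _ h Δ σ τ hs => (hS hs).ivar _ _ h
  · intro Γ f Δ' A ls _ _ hd _ hl Δ σ τ hs
    -- The argument and result types are a single constant, so the substitution of earlier arguments
    -- into later types disappears.
    obtain ⟨c, hc, hA, hΔ⟩ := hT.conf _ _ _ hd
    have := HasTypeC.fn (ls := fun k => (ls k).subst τ) (hS hs).wf hd fun k => by
      have := hl k Δ σ τ hs
      rw [hΔ k] at this ⊢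
      exact this
    rw [hA] at this ⊢
    exact this
  · exact fun _ h _ h' hc Δ σ τ hs => .conv (h _ _ _ hs) (h' _ _ _ hs) (hconv hs hc)

/-- `ρ, ξ` is a renaming from `Γ` to the context `Δ`. -/
structure TypedRenaming (T : Theory C ar) (Δ : Ctx C ar) (ρ ξ : ℕ → ℕ) (Γ : Ctx C ar) :
    Prop where
  wf : WfCtx T Δ
  var : ∀ n A, LookupVar Γ n A → LookupVar Δ (ρ n) (A.rename ρ ξ)
  ivar : ∀ n A, LookupVarC Γ n A → LookupVarC Δ (ξ n) (A.rename ρ ξ)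

/-- Renamings are treated before general substitutions because lifting a typed substitution weakens
its values. A lifted renaming needs only variable lookups, so the class of renamings is closed under
lifting without appeal to weakening. -/
theorem typing_rename (hT : WellTyped T) {Δ Γ : Ctx C ar} {ρ ξ : ℕ → ℕ}
    (hr : TypedRenaming T Δ ρ ξ Γ) :
    (∀ {t A}, HasType T Γ t A → HasType T Δ (t.rename ρ ξ) (A.rename ρ ξ)) ∧
      ∀ {l A}, HasTypeC T Γ l A → HasTypeC T Δ (l.rename ξ) (A.rename ρ ξ) := by
  have key := typing_subst_of_class hT
    (S := fun Δ σ τ Γ => ∃ ρ ξ, TypedRenaming T Δ ρ ξ Γ ∧ σ = (fun n => .var (ρ n)) ∧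
      τ = fun n => .ivar (ξ n)) ?_ ?_ ?_
  · simp only [Term.rename_eq_subst, CTerm.rename_eq_subst]
    exact ⟨fun h => key.2.1 h _ _ _ ⟨ρ, ξ, hr, rfl, rfl⟩,
      fun h => key.2.2 h _ _ _ ⟨ρ, ξ, hr, rfl, rfl⟩⟩
  · rintro Δ _ _ Γ ⟨ρ, ξ, hr, rfl, rfl⟩
    refine ⟨hr.wf, fun n A h => ?_, fun n A h => ?_, fun _ => trivial, fun _ => trivial⟩
    · rw [← Term.rename_eq_subst]; exact .var hr.wf (hr.var _ _ h)
    · rw [← Term.rename_eq_subst]; exact .ivar hr.wf (hr.ivar _ _ h)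
  · rintro Δ _ _ Γ A ⟨ρ, ξ, hr, rfl, rfl⟩ hA
    refine ⟨liftRen ρ, ξ, ⟨.ext hA, ?_, ?_⟩, up_var ρ, rfl⟩
    · rw [← Term.rename_eq_subst]
      rintro _ _ (_ | @⟨_, n, B, _, h⟩ | _)
      · have := LookupVar.here (Γ := Δ) (A := A.rename ρ ξ)
        simp only [Term.shift, Term.rename_rename] at this ⊢
        exact this
      · have := LookupVar.thereReg (B := A.rename ρ ξ) (hr.var _ _ h)
        simp only [Term.shift, Term.rename_rename] at this ⊢
        exact this
    · rw [← Term.rename_eq_subst]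
      rintro _ _ (_ | @⟨_, n, B, _, h⟩ | _)
      have := LookupVarC.thereReg (B := A.rename ρ ξ) (hr.ivar _ _ h)
      simp only [Term.shift, Term.rename_rename] at this ⊢
      exact this
  · rintro Δ _ _ Γ A ⟨ρ, ξ, hr, rfl, rfl⟩ hA
    refine ⟨ρ, liftRen ξ, ⟨.extC hA, ?_, ?_⟩, rfl, upC_ivar ξ⟩
    · rw [← Term.rename_eq_subst]
      rintro _ _ (_ | _ | @⟨_, n, B, _, h⟩)
      have := LookupVar.thereConf (B := A.rename ρ ξ) (hr.var _ _ h)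
      simp only [Term.shiftC, Term.rename_rename] at this ⊢
      exact this
    · rw [← Term.rename_eq_subst]
      rintro _ _ (_ | _ | @⟨_, n, B, _, h⟩)
      · have := LookupVarC.here (Γ := Δ) (A := A.rename ρ ξ)
        simp only [Term.shiftC, Term.rename_rename] at this ⊢
        exact this
      · have := LookupVarC.thereConf (B := A.rename ρ ξ) (hr.ivar _ _ h)
        simp only [Term.shiftC, Term.rename_rename] at this ⊢
        exact this

theorem typedRenaming_reg {Γ : Ctx C ar} {A : Term C ar} (hA : HasType T Γ A (.sort .type)) :
    TypedRenaming T (.reg A :: Γ) Nat.succ id Γ :=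
  ⟨.ext hA, fun _ _ => .thereReg, fun _ _ => .thereReg⟩

theorem typedRenaming_conf {Γ : Ctx C ar} {A : Term C ar} (hA : HasType T Γ A (.sort .type)) :
    TypedRenaming T (.conf A :: Γ) id Nat.succ Γ :=
  ⟨.extC hA, fun _ _ => .thereConf, fun _ _ => .thereConf⟩

theorem HasType.shift (hT : WellTyped T) {Γ : Ctx C ar} {t A B : Term C ar}
    (h : HasType T Γ t A) (hB : HasType T Γ B (.sort .type)) :
    HasType T (.reg B :: Γ) t.shift A.shift := (typing_rename hT (typedRenaming_reg hB)).1 h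

theorem HasType.shiftC (hT : WellTyped T) {Γ : Ctx C ar} {t A B : Term C ar}
    (h : HasType T Γ t A) (hB : HasType T Γ B (.sort .type)) :
    HasType T (.conf B :: Γ) t.shiftC A.shiftC := (typing_rename hT (typedRenaming_conf hB)).1 h

theorem HasTypeC.shift (hT : WellTyped T) {Γ : Ctx C ar} {l : CTerm ar} {A B : Term C ar}
    (h : HasTypeC T Γ l A) (hB : HasType T Γ B (.sort .type)) :
    HasTypeC T (.reg B :: Γ) l A.shift := by
  have := (typing_rename hT (typedRenaming_reg hB)).2 h
  rwa [CTerm.rename_eq_subst, show (fun n => CTerm.ivar (id n)) = (CTerm.ivar : ℕ → CTerm ar)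
    from rfl, CTerm.subst_ivar] at this

theorem HasTypeC.shiftC (hT : WellTyped T) {Γ : Ctx C ar} {l : CTerm ar} {A B : Term C ar}
    (h : HasTypeC T Γ l A) (hB : HasType T Γ B (.sort .type)) :
    HasTypeC T (.conf B :: Γ) l.shiftC A.shiftC := (typing_rename hT (typedRenaming_conf hB)).2 h

theorem TypedSubst.up (hT : WellTyped T) {Δ Γ : Ctx C ar} {σ : ℕ → Term C ar} {τ : ℕ → CTerm ar}
    {A : Term C ar} (hs : TypedSubst T Δ σ τ Γ) (hA : HasType T Δ (A.subst σ τ) (.sort .type)) :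
    TypedSubst T (.reg (A.subst σ τ) :: Δ) (up σ) τ (.reg A :: Γ) := by
  refine ⟨.ext hA, ?_, ?_, ?_, hs.overSigC⟩
  · rintro _ _ (_ | @⟨_, n, B, _, h⟩ | _)
    · rw [← Term.shift_subst]
      exact .var (.ext hA) .here
    · rw [← Term.shift_subst]
      exact (hs.var _ _ h).shift hT hA
  · rintro _ _ (_ | @⟨_, n, B, _, h⟩ | _)
    rw [← Term.shift_subst]
    exact (hs.ivar _ _ h).shift hT hA
  · rintro (_ | n)
    · trivial
    · simp only [Dedukti.up, scons, Term.shift_eq_subst]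
      exact (hs.overSig n).subst (fun _ => trivial) fun _ => trivial

theorem TypedSubst.upC (hT : WellTyped T) {Δ Γ : Ctx C ar} {σ : ℕ → Term C ar} {τ : ℕ → CTerm ar}
    {A : Term C ar} (hs : TypedSubst T Δ σ τ Γ) (hA : HasType T Δ (A.subst σ τ) (.sort .type)) :
    TypedSubst T (.conf (A.subst σ τ) :: Δ) (upShiftC σ) (upC τ) (.conf A :: Γ) := by
  refine ⟨.extC hA, ?_, ?_, ?_, ?_⟩
  · rintro _ _ (_ | _ | @⟨_, n, B, _, h⟩)
    rw [← Term.shiftC_subst]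
    exact (hs.var _ _ h).shiftC hT hA
  · rintro _ _ (_ | _ | @⟨_, n, B, _, h⟩)
    · rw [← Term.shiftC_subst]
      exact .ivar (.extC hA) .here
    · rw [← Term.shiftC_subst]
      exact (hs.ivar _ _ h).shiftC hT hA
  · intro n
    simp only [upShiftC, Term.shiftC_eq_subst]
    exact (hs.overSig n).subst (fun _ => trivial) fun _ => trivial
  · rintro (_ | n)
    · trivial
    · simp only [Dedukti.upC, scons, CTerm.shiftC, CTerm.rename_eq_subst]
      exact (hs.overSigC n).subst fun _ => trivial

theorem HasType.subst (hT : WellTyped T) {Δ Γ : Ctx C ar} {σ : ℕ → Term C ar} {τ : ℕ → CTerm ar}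
    {t A : Term C ar} (h : HasType T Γ t A) (hs : TypedSubst T Δ σ τ Γ) :
    HasType T Δ (t.subst σ τ) (A.subst σ τ) :=
  (typing_subst_of_class hT (S := TypedSubst T) id (.up hT) (.upC hT)).2.1 h _ _ _ hs

theorem HasType.inst (hT : WellTyped T) {Γ : Ctx C ar} {t A u B : Term C ar}
    (h : HasType T (.reg A :: Γ) t B) (hu : HasType T Γ u A) :
    HasType T Γ (t.inst u) (B.inst u) := by
  refine h.subst hT ⟨hu.wfCtx, ?_, ?_, ?_, fun _ => trivial⟩
  · rintro _ _ (_ | @⟨_, n, B, _, h⟩ | _)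
    · change HasType T Γ u (A.shift.inst u)
      rwa [Term.shift_inst]
    · change HasType T Γ (.var n) (B.shift.inst u)
      rw [Term.shift_inst]
      exact .var hu.wfCtx h
  · rintro _ _ (_ | @⟨_, n, B, _, h⟩ | _)
    change HasTypeC T Γ (.ivar _) (B.shift.inst u)
    rw [Term.shift_inst]
    exact .ivar hu.wfCtx h
  · rintro (_ | n)
    exacts [hu.overSig, trivial]

theorem HasTypeC.wfCtx {Γ : Ctx C ar} {l : CTerm ar} {A : Term C ar} (h : HasTypeC T Γ l A) :
    WfCtx T Γ := by
  cases h with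
  | ivar h => exact h
  | fn h => exact h
  | conv _ h => exact h.wfCtx

theorem HasType.instC (hT : WellTyped T) {Γ : Ctx C ar} {t A B : Term C ar} {l : CTerm ar}
    (h : HasType T (.conf A :: Γ) t B) (hl : HasTypeC T Γ l A) :
    HasType T Γ (t.instC l) (B.instC l) := by
  refine h.subst hT ⟨hl.wfCtx, ?_, ?_, fun _ => trivial, ?_⟩
  · rintro _ _ (_ | _ | @⟨_, n, B, _, h⟩)
    change HasType T Γ (.var _) (B.shiftC.instC l)
    rw [Term.shiftC_instC]
    exact .var hl.wfCtx h
  · rintro _ _ (_ | _ | @⟨_, n, B, _, h⟩)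
    · change HasTypeC T Γ l (A.shiftC.instC l)
      rwa [Term.shiftC_instC]
    · change HasTypeC T Γ (.ivar n) (B.shiftC.instC l)
      rw [Term.shiftC_instC]
      exact .ivar hl.wfCtx h
  · rintro (_ | n)
    exacts [hl.over, trivial]

theorem HasType.weaken_nil (hT : WellTyped T) {Γ : Ctx C ar} {t A : Term C ar}
    (h : HasType T [] t A) (hA : A.Closed) (hΓ : WfCtx T Γ) : HasType T Γ t A := by
  have := (typing_rename hT (ρ := id) (ξ := id)
    ⟨hΓ, fun _ _ h => (by cases h), fun _ _ h => (by cases h)⟩).1 h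
  rwa [Term.rename_eq_subst, Term.rename_eq_subst, hA, h.closed] at this

/-- The identity is a well-typed substitution between the two contexts: the new variable has type
`A'` and is used at type `A` through the conversion rule. -/
theorem HasType.ctx_reg (hT : WellTyped T) {Γ : Ctx C ar} {t A A' B : Term C ar}
    (h : HasType T (.reg A :: Γ) t B) (hA : HasType T Γ A (.sort .type))
    (hA' : HasType T Γ A' (.sort .type)) (hc : T.Conv A' A) : HasType T (.reg A' :: Γ) t B := by
  have := h.subst hT (Δ := .reg A' :: Γ) (σ := .var) (τ := .ivar)
    ⟨.ext hA', ?_, ?_, fun _ => trivial, fun _ => trivial⟩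
  · simpa using this
  · rintro _ _ (_ | @⟨_, n, B, _, h⟩ | _) <;> rw [Term.subst_id]
    · exact .conv (.var (.ext hA') .here) (hA.shift hT hA') (hc.shift hT.closedBodies)
    · exact .var (.ext hA') (.thereReg h)
  · rintro _ _ (_ | @⟨_, n, B, _, h⟩ | _)
    rw [Term.subst_id]
    exact .ivar (.ext hA') (.thereReg h)

theorem HasType.ctx_conf (hT : WellTyped T) {Γ : Ctx C ar} {t A A' B : Term C ar}
    (h : HasType T (.conf A :: Γ) t B) (hA : HasType T Γ A (.sort .type))
    (hA' : HasType T Γ A' (.sort .type)) (hc : T.Conv A' A) : HasType T (.conf A' :: Γ) t B := by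
  have := h.subst hT (Δ := .conf A' :: Γ) (σ := .var) (τ := .ivar)
    ⟨.extC hA', ?_, ?_, fun _ => trivial, fun _ => trivial⟩
  · simpa using this
  · rintro _ _ (_ | _ | @⟨_, n, B, _, h⟩)
    rw [Term.subst_id]
    exact .var (.extC hA') (.thereConf h)
  · rintro _ _ (_ | _ | @⟨_, n, B, _, h⟩) <;> rw [Term.subst_id]
    · refine .conv (.ivar (.extC hA') .here) (hA.shiftC hT hA') ?_
      simp only [Term.shiftC_eq_subst]
      exact hc.subst hT.closedBodies (fun _ => trivial) fun _ => trivial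
    · exact .ivar (.extC hA') (.thereConf h)

/-! ## Inversion of typing -/

/-- A term of type `A` has type `B`, by at most one conversion. -/
def ConvType (T : Theory C ar) (Γ : Ctx C ar) (A B : Term C ar) : Prop :=
  A = B ∨ T.Conv A B ∧ ∃ s, HasType T Γ B (.sort s)

namespace ConvType

variable {Γ : Ctx C ar} {A B D t : Term C ar}

theorem conv (h : ConvType T Γ A B) : T.Conv A B := by
  rcases h with rfl | h
  exacts [.refl _, h.1]

theorem trans (h : ConvType T Γ A B) (h' : ConvType T Γ B D) : ConvType T Γ A D := by
  rcases h' with rfl | h'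
  · exact h
  · exact .inr ⟨h.conv.trans h'.1, h'.2⟩

theorem hasType (h : ConvType T Γ A B) (ht : HasType T Γ t A) : HasType T Γ t B := by
  rcases h with rfl | ⟨h, s, hB⟩
  exacts [ht, .conv ht hB h]

end ConvType

namespace HasType

variable {Γ : Ctx C ar} {A B D t u : Term C ar} {l : CTerm ar}

/-- A derivation ends with the rule for the head symbol followed by conversions, which compose into
at most one. The equality alternative in `ConvType` is necessary: with no conversion the type may be
`Kind`, which has no sort. -/
theorem const_inv {c : C} (h : HasType T Γ (.const c) D) :
    ∃ A, Declares T c A ∧ ConvType T Γ A D := by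
  generalize ht : Term.const c = t at h
  revert ht
  refine (typing_induction (T := T) (W := fun _ => True)
    (P := fun Γ t D => Term.const c = t → ∃ A, Declares T c A ∧ ConvType T Γ A D)
    (Q := fun _ _ _ => True) ?_ ?_ ?_ ?_ ?_ ?_ ?_ ?_ ?_ ?_ ?_ ?_ ?_ ?_ ?_ ?_ ?_).2.1 h
  all_goals try (intros; trivial)
  · rintro _ _ _ _ _ h ⟨⟩; exact ⟨_, .inl h, .inl rfl⟩
  · rintro _ _ _ _ _ _ h ⟨⟩; exact ⟨_, .inr ⟨_, h⟩, .inl rfl⟩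
  · intro _ _ _ _ _ _ ih hB _ hc ht
    obtain ⟨A, hA, h⟩ := ih ht
    exact ⟨A, hA, h.trans (.inr ⟨hc, _, hB⟩)⟩

theorem pi_inv (h : HasType T Γ (.pi A B) D) :
    ∃ s, HasType T Γ A (.sort .type) ∧ HasType T (.reg A :: Γ) B (.sort s) ∧
      ConvType T Γ (.sort s) D := by
  generalize ht : Term.pi A B = t at h
  revert ht
  refine (typing_induction (T := T) (W := fun _ => True)
    (P := fun Γ t D => Term.pi A B = t → ∃ s, HasType T Γ A (.sort .type) ∧
      HasType T (.reg A :: Γ) B (.sort s) ∧ ConvType T Γ (.sort s) D)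
    (Q := fun _ _ _ => True) ?_ ?_ ?_ ?_ ?_ ?_ ?_ ?_ ?_ ?_ ?_ ?_ ?_ ?_ ?_ ?_ ?_).2.1 h
  all_goals try (intros; trivial)
  · intro _ _ _ _ _ _ ih hB _ hc ht
    obtain ⟨s, h1, h2, h⟩ := ih ht
    exact ⟨s, h1, h2, h.trans (.inr ⟨hc, _, hB⟩)⟩
  · rintro _ _ _ _ h1 _ h2 _ ⟨⟩; exact ⟨_, h1, h2, .inl rfl⟩

theorem piC_inv (h : HasType T Γ (.piC A B) D) :
    ∃ s, HasType T Γ A (.sort .type) ∧ HasType T (.conf A :: Γ) B (.sort s) ∧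
      ConvType T Γ (.sort s) D := by
  generalize ht : Term.piC A B = t at h
  revert ht
  refine (typing_induction (T := T) (W := fun _ => True)
    (P := fun Γ t D => Term.piC A B = t → ∃ s, HasType T Γ A (.sort .type) ∧
      HasType T (.conf A :: Γ) B (.sort s) ∧ ConvType T Γ (.sort s) D)
    (Q := fun _ _ _ => True) ?_ ?_ ?_ ?_ ?_ ?_ ?_ ?_ ?_ ?_ ?_ ?_ ?_ ?_ ?_ ?_ ?_).2.1 h
  all_goals try (intros; trivial)
  · intro _ _ _ _ _ _ ih hB _ hc ht
    obtain ⟨s, h1, h2, h⟩ := ih ht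
    exact ⟨s, h1, h2, h.trans (.inr ⟨hc, _, hB⟩)⟩
  · rintro _ _ _ _ h1 _ h2 _ ⟨⟩; exact ⟨_, h1, h2, .inl rfl⟩

theorem abs_inv (h : HasType T Γ (.abs t) D) :
    ∃ A B s, HasType T Γ A (.sort .type) ∧ HasType T (.reg A :: Γ) B (.sort s) ∧
      HasType T (.reg A :: Γ) t B ∧ ConvType T Γ (.pi A B) D := by
  generalize ht : Term.abs t = t' at h
  revert ht
  refine (typing_induction (T := T) (W := fun _ => True)
    (P := fun Γ t' D => Term.abs t = t' → ∃ A B s, HasType T Γ A (.sort .type) ∧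
      HasType T (.reg A :: Γ) B (.sort s) ∧ HasType T (.reg A :: Γ) t B ∧
      ConvType T Γ (.pi A B) D)
    (Q := fun _ _ _ => True) ?_ ?_ ?_ ?_ ?_ ?_ ?_ ?_ ?_ ?_ ?_ ?_ ?_ ?_ ?_ ?_ ?_).2.1 h
  all_goals try (intros; trivial)
  · intro _ _ _ _ _ _ ih hB _ hc ht
    obtain ⟨A, B, s, h1, h2, h3, h⟩ := ih ht
    exact ⟨A, B, s, h1, h2, h3, h.trans (.inr ⟨hc, _, hB⟩)⟩
  · rintro _ _ _ _ _ h1 _ h2 _ h3 _ ⟨⟩; exact ⟨_, _, _, h1, h2, h3, .inl rfl⟩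

theorem absC_inv (h : HasType T Γ (.absC t) D) :
    ∃ A B s, HasType T Γ A (.sort .type) ∧ HasType T (.conf A :: Γ) B (.sort s) ∧
      HasType T (.conf A :: Γ) t B ∧ ConvType T Γ (.piC A B) D := by
  generalize ht : Term.absC t = t' at h
  revert ht
  refine (typing_induction (T := T) (W := fun _ => True)
    (P := fun Γ t' D => Term.absC t = t' → ∃ A B s, HasType T Γ A (.sort .type) ∧
      HasType T (.conf A :: Γ) B (.sort s) ∧ HasType T (.conf A :: Γ) t B ∧
      ConvType T Γ (.piC A B) D)
    (Q := fun _ _ _ => True) ?_ ?_ ?_ ?_ ?_ ?_ ?_ ?_ ?_ ?_ ?_ ?_ ?_ ?_ ?_ ?_ ?_).2.1 h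
  all_goals try (intros; trivial)
  · intro _ _ _ _ _ _ ih hB _ hc ht
    obtain ⟨A, B, s, h1, h2, h3, h⟩ := ih ht
    exact ⟨A, B, s, h1, h2, h3, h.trans (.inr ⟨hc, _, hB⟩)⟩
  · rintro _ _ _ _ _ h1 _ h2 _ h3 _ ⟨⟩; exact ⟨_, _, _, h1, h2, h3, .inl rfl⟩

theorem app_inv (h : HasType T Γ (.app t u) D) :
    ∃ A B, HasType T Γ t (.pi A B) ∧ HasType T Γ u A ∧ ConvType T Γ (B.inst u) D := by
  generalize ht : Term.app t u = t' at h
  revert ht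
  refine (typing_induction (T := T) (W := fun _ => True)
    (P := fun Γ t' D => Term.app t u = t' → ∃ A B, HasType T Γ t (.pi A B) ∧ HasType T Γ u A ∧
      ConvType T Γ (B.inst u) D)
    (Q := fun _ _ _ => True) ?_ ?_ ?_ ?_ ?_ ?_ ?_ ?_ ?_ ?_ ?_ ?_ ?_ ?_ ?_ ?_ ?_).2.1 h
  all_goals try (intros; trivial)
  · intro _ _ _ _ _ _ ih hB _ hc ht
    obtain ⟨A, B, h1, h2, h⟩ := ih ht
    exact ⟨A, B, h1, h2, h.trans (.inr ⟨hc, _, hB⟩)⟩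
  · rintro _ _ _ _ _ h1 _ h2 _ ⟨⟩; exact ⟨_, _, h1, h2, .inl rfl⟩

theorem appC_inv (h : HasType T Γ (.appC t l) D) :
    ∃ A B, HasType T Γ t (.piC A B) ∧ HasTypeC T Γ l A ∧ ConvType T Γ (B.instC l) D := by
  generalize ht : Term.appC t l = t' at h
  revert ht
  refine (typing_induction (T := T) (W := fun _ => True)
    (P := fun Γ t' D => Term.appC t l = t' → ∃ A B, HasType T Γ t (.piC A B) ∧
      HasTypeC T Γ l A ∧ ConvType T Γ (B.instC l) D)
    (Q := fun _ _ _ => True) ?_ ?_ ?_ ?_ ?_ ?_ ?_ ?_ ?_ ?_ ?_ ?_ ?_ ?_ ?_ ?_ ?_).2.1 h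
  all_goals try (intros; trivial)
  · intro _ _ _ _ _ _ ih hB _ hc ht
    obtain ⟨A, B, h1, h2, h⟩ := ih ht
    exact ⟨A, B, h1, h2, h.trans (.inr ⟨hc, _, hB⟩)⟩
  · rintro _ _ _ _ _ h1 _ h2 _ ⟨⟩; exact ⟨_, _, h1, h2, .inl rfl⟩

end HasType

/-! ## Types are well-typed -/

/-- The types in a context, and the types of terms and confined terms, are well-typed. -/
theorem typing_isType (hT : WellTyped T) :
    (∀ {Γ}, WfCtx T Γ → (∀ n A, LookupVar Γ n A → HasType T Γ A (.sort .type)) ∧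
        ∀ n A, LookupVarC Γ n A → HasType T Γ A (.sort .type)) ∧
      (∀ {Γ t A}, HasType T Γ t A → WfCtx T Γ ∧
        ((∀ n A, LookupVar Γ n A → HasType T Γ A (.sort .type)) ∧
          ∀ n A, LookupVarC Γ n A → HasType T Γ A (.sort .type)) ∧ IsType T Γ A) ∧
      (∀ {Γ l A}, HasTypeC T Γ l A → HasType T Γ A (.sort .type)) := by
  have hdecl : ∀ {Γ c A}, WfCtx T Γ → Declares T c A → IsType T Γ A := by
    intro Γ c A hΓ h
    exact (hT.isType _ _ h).imp_right fun ⟨s, h⟩ => ⟨s, h.weaken_nil hT (fun _ _ => rfl) hΓ⟩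
  refine typing_induction (T := T)
    (W := fun Γ => (∀ n A, LookupVar Γ n A → HasType T Γ A (.sort .type)) ∧
        ∀ n A, LookupVarC Γ n A → HasType T Γ A (.sort .type))
    -- The rule extending a context has a typing of the new entry as its only premise, so the claim
    -- about the old context must travel with the typing judgment.
    (P := fun Γ t A => WfCtx T Γ ∧
      ((∀ n A, LookupVar Γ n A → HasType T Γ A (.sort .type)) ∧
        ∀ n A, LookupVarC Γ n A → HasType T Γ A (.sort .type)) ∧ IsType T Γ A)
    (Q := fun Γ _ A => HasType T Γ A (.sort .type))
    ?_ ?_ ?_ ?_ ?_ ?_ ?_ ?_ ?_ ?_ ?_ ?_ ?_ ?_ ?_ ?_ ?_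
  · exact ⟨fun _ _ h => (nomatch h), fun _ _ h => (nomatch h)⟩
  · intro Γ A hA ⟨_, ih, _⟩
    constructor
    · rintro _ _ (_ | @⟨_, n, B, _, h⟩ | _)
      · exact hA.shift hT hA
      · exact (ih.1 _ _ h).shift hT hA
    · rintro _ _ (_ | @⟨_, n, B, _, h⟩ | _)
      exact (ih.2 _ _ h).shift hT hA
  · intro Γ A hA ⟨_, ih, _⟩
    constructor
    · rintro _ _ (_ | _ | @⟨_, n, B, _, h⟩)
      exact (ih.1 _ _ h).shiftC hT hA
    · rintro _ _ (_ | _ | @⟨_, n, B, _, h⟩)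
      · exact hA.shiftC hT hA
      · exact (ih.2 _ _ h).shiftC hT hA
  · exact fun hΓ h => ⟨hΓ, h, .inl rfl⟩
  · exact fun hΓ h h' => ⟨hΓ, h, .inr ⟨_, h.1 _ _ h'⟩⟩
  · exact fun hΓ h h' => ⟨hΓ, h, hdecl hΓ (.inl h')⟩
  · exact fun hΓ h h' => ⟨hΓ, h, hdecl hΓ (.inr ⟨_, h'⟩)⟩
  · exact fun _ h hB _ _ => ⟨h.1, h.2.1, .inr ⟨_, hB⟩⟩
  · rintro Γ A B s - h - h'
    refine ⟨h.1, h.2.1, ?_⟩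
    cases s
    · exact .inr ⟨_, .sort h.1⟩
    · exact .inl rfl
  · rintro Γ A B s - h - h'
    refine ⟨h.1, h.2.1, ?_⟩
    cases s
    · exact .inr ⟨_, .sort h.1⟩
    · exact .inl rfl
  · exact fun hA h hB _ _ _ => ⟨h.1, h.2.1, .inr ⟨_, .pi hA hB⟩⟩
  · exact fun hA h hB _ _ _ => ⟨h.1, h.2.1, .inr ⟨_, .piC hA hB⟩⟩
  · rintro Γ A B t u - ⟨h1, h2, h | ⟨s, h⟩⟩ hu -
    · contradiction
    · obtain ⟨s', -, hB, -⟩ := h.pi_inv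
      exact ⟨h1, h2, .inr ⟨s', hB.inst hT hu⟩⟩
  · rintro Γ A B t l - ⟨h1, h2, h | ⟨s, h⟩⟩ hl -
    · contradiction
    · obtain ⟨s', -, hB, -⟩ := h.piC_inv
      exact ⟨h1, h2, .inr ⟨s', hB.instC hT hl⟩⟩
  · exact fun _ h h' => h.2 _ _ h'
  · intro Γ f Δ A ls hΓ _ hd _ _
    obtain ⟨c, hc, rfl, -⟩ := hT.conf _ _ _ hd
    exact .const hΓ hc
  · exact fun _ _ h _ _ => h

theorem HasType.isType (hT : WellTyped T) {Γ : Ctx C ar} {t A : Term C ar}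
    (h : HasType T Γ t A) : IsType T Γ A := ((typing_isType hT).2.1 h).2.2

theorem IsType.overSig {Γ : Ctx C ar} {A : Term C ar} (h : IsType T Γ A) : A.OverSig T.sig := by
  rcases h with rfl | ⟨s, h⟩
  exacts [trivial, h.overSig]

theorem HasType.overSig_right (hT : WellTyped T) {Γ : Ctx C ar} {t A : Term C ar}
    (h : HasType T Γ t A) : A.OverSig T.sig := (h.isType hT).overSig

theorem HasType.isType_pi (hT : WellTyped T) {Γ : Ctx C ar} {t A B : Term C ar}
    (h : HasType T Γ t (.pi A B)) :
    ∃ s, HasType T Γ A (.sort .type) ∧ HasType T (.reg A :: Γ) B (.sort s) := by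
  rcases h.isType hT with h | ⟨s, h⟩
  · contradiction
  · obtain ⟨s', hA, hB, -⟩ := h.pi_inv
    exact ⟨s', hA, hB⟩

theorem HasType.isType_piC (hT : WellTyped T) {Γ : Ctx C ar} {t A B : Term C ar}
    (h : HasType T Γ t (.piC A B)) :
    ∃ s, HasType T Γ A (.sort .type) ∧ HasType T (.conf A :: Γ) B (.sort s) := by
  rcases h.isType hT with h | ⟨s, h⟩
  · contradiction
  · obtain ⟨s', hA, hB, -⟩ := h.piC_inv
    exact ⟨s', hA, hB⟩

/-! ## Well-formed theories are well-typed -/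

theorem WellTyped.mono {T' : Theory C ar} (hT : WellTyped T) (h : T.Sub T')
    (hsig : ∀ d ∈ T'.sig, d ∈ T.sig) : WellTyped T' where
  isType c A hA := by
    have hA : Declares T c A := hA.imp (hsig _) fun ⟨t, ht⟩ => ⟨t, hsig _ ht⟩
    exact (hT.isType c A hA).imp_right fun ⟨s, hs⟩ => ⟨s, hs.mono h⟩
  defn c A t ht := (hT.defn _ _ _ (hsig _ ht)).mono h
  conf f Δ A hf := by
    obtain ⟨c, hc, h'⟩ := hT.conf _ _ _ (hsig _ hf)
    exact ⟨c, h.sig _ hc, h'⟩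

theorem Theory.restrict_sub {S S' : List (Decl C ar)} (h : ∀ d ∈ S, d ∈ S') :
    (T.restrict S).Sub (T.restrict S') where
  sig := h
  rules := fun _ hr =>
    ⟨hr.1,
      hr.2.1.mono (fun _ => List.map_subset _ h (a := _)) fun _ => List.map_subset _ h (a := _),
      hr.2.2.mono (fun _ => List.map_subset _ h (a := _)) fun _ => List.map_subset _ h (a := _)⟩
  eqs := fun _ hr => ⟨hr.1, hr.2.1.mono fun _ => List.map_subset _ h (a := _),
    hr.2.2.mono fun _ => List.map_subset _ h (a := _)⟩

/-- Induction on prefixes of the signature: the metatheory is available for a prefix once its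
entries are known to be well-typed, and it then serves for the next entry. Typings move to larger
prefixes by monotonicity. -/
theorem Theory.WellFormed.wellTyped (hT : T.WellFormed)
    (hconf : ∀ S S', T.sig = S ++ S' → ∀ f Δ A, Decl.conf f Δ A ∈ S →
      ∃ c, Decl.const c (.sort .type) ∈ S ∧ A = .const c ∧ ∀ k, Δ k = .const c) :
    WellTyped T := by
  have key : ∀ S S', T.sig = S ++ S' → WellTyped (T.restrict S) := by
    intro S
    induction S using List.reverseRecOn with
    | nil =>
      intro S' _
      exact ⟨fun _ _ h => by simp [Declares, Theory.restrict] at h,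
        fun _ _ _ h => by simp [Theory.restrict] at h,
        fun _ _ _ h => by simp [Theory.restrict] at h⟩
    | append_singleton S d ih =>
      intro S' hS
      have hS' : T.sig = S ++ d :: S' := by simpa using hS
      have hS₁ := ih _ hS'
      have hd := hT.2 _ _ _ hS'
      have hsub : (T.restrict S).Sub (T.restrict (S ++ [d])) :=
        Theory.restrict_sub fun _ h => List.mem_append_left _ h
      refine ⟨fun c A h => ?_, fun c A t h => ?_, hconf _ _ hS⟩
      · have : IsType (T.restrict S) [] A := by
          rcases h with h | ⟨t, h⟩
          · rcases List.mem_append.1 h with h | h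
            · exact hS₁.isType _ _ (.inl h)
            · obtain rfl := List.mem_singleton.1 h
              exact .inr hd
          · rcases List.mem_append.1 h with h | h
            · exact hS₁.isType _ _ (.inr ⟨_, h⟩)
            · obtain rfl := List.mem_singleton.1 h
              -- Validity of a definition asserts nothing about its type directly; well-typedness of
              -- types in the prefix supplies it.
              exact HasType.isType hS₁ hd
        exact this.imp_right fun ⟨s, hs⟩ => ⟨s, hs.mono hsub⟩
      · rcases List.mem_append.1 h with h | h
        · exact (hS₁.defn _ _ _ h).mono hsub
        · obtain rfl := List.mem_singleton.1 h
          exact HasType.mono hsub hd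
  exact (key T.sig [] (by simp)).mono
    ⟨fun _ h => h, fun _ h => h.1, fun _ h => h.1⟩ fun _ h => h

end Dedukti

namespace UPP

open Dedukti Relation

universe w

variable {L : Type w}

/-! ## Parallel reduction modulo conversion of levels -/

/-- Conversion of confined terms. -/
def LevelConv (T : Theory (Const L) arity) : Level → Level → Prop := EqvGen (CompatC T.EqRoot)

/-- Parallel reduction, up to conversion of levels. -/
inductive Par (T : Theory (Const L) arity) : Trm L → Trm L → Prop
  | var (n) : Par T (.var n) (.var n)
  | const (c) : Par T (.const c) (.const c)
  | sort (s) : Par T (.sort s) (.sort s)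
  | pi {A A' B B'} : Par T A A' → Par T B B' → Par T (.pi A B) (.pi A' B')
  | abs {t t'} : Par T t t' → Par T (.abs t) (.abs t')
  | app {t t' u u'} : Par T t t' → Par T u u' → Par T (.app t u) (.app t' u')
  | piC {A A' B B'} : Par T A A' → Par T B B' → Par T (.piC A B) (.piC A' B')
  | absC {t t'} : Par T t t' → Par T (.absC t) (.absC t')
  | appC {t t' l l'} : Par T t t' → LevelConv T l l' → Par T (.appC t l) (.appC t' l')
  | beta {t t' u u'} : Par T t t' → Par T u u' → Par T (.app (.abs t) u) (t'.inst u')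
  | betaC {t t' l l'} : Par T t t' → LevelConv T l l' → Par T (.appC (.absC t) l) (t'.instC l')
  | delta {c A t} : Decl.defn c A t ∈ T.sig → Par T (.const c) t
  | tmU {k l l'} : LevelConv T l l' →
      Par T (.app (.appC (.const .Tm) k) (.appC (.const .U) l)) (.appC (.const .Ty) l')
  | appLam {l l' k k' A B A' B' t t' u u'} : Par T t t' → Par T u u' →
      Par T (.app (.app (.app (.app (.appC (.appC (.const .App) l) l') A) B)
        (.app (.app (.app (.appC (.appC (.const .Lam) k) k') A') B') t)) u) (.app t' u')

/-- The constant has no definition. -/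
def Undefined (T : Theory (Const L) arity) (c : Const L) : Prop :=
  ∀ A t, Decl.defn c A t ∉ T.sig

variable {T : Theory (Const L) arity}

namespace LevelConv

theorem refl (l : Level) : LevelConv T l l := EqvGen.refl l

theorem symm {l l' : Level} (h : LevelConv T l l') : LevelConv T l' l := EqvGen.symm _ _ h

theorem trans {l l' k : Level} (h : LevelConv T l l') (h' : LevelConv T l' k) :
    LevelConv T l k := EqvGen.trans _ _ _ h h'

theorem map {f : Level → Level}
    (hf : ∀ l l', CompatC T.EqRoot l l' → CompatC T.EqRoot (f l) (f l')) {l l' : Level}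
    (h : LevelConv T l l') : LevelConv T (f l) (f l') := by
  induction h with
  | refl a => exact .refl _
  | rel a b hab => exact EqvGen.rel _ _ (hf _ _ hab)
  | symm _ _ _ ih => exact ih.symm
  | trans _ _ _ _ _ ih ih' => exact ih.trans ih'

/-- The closure by context acts on one argument per step, so the arguments are exchanged one after
another, by induction on the finite set of positions already changed. -/
theorem fn {f : Conf} {ls ls' : Fin (arity f) → Level} (h : ∀ k, LevelConv T (ls k) (ls' k)) :
    LevelConv T (.fn f ls) (.fn f ls') := by
  have hup : ∀ (ls : Fin (arity f) → Level) (k) {a b : Level}, LevelConv T a b →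
      LevelConv T (.fn f (Function.update ls k a)) (.fn f (Function.update ls k b)) := by
    intro ls k a b hab
    refine hab.map (f := fun a => .fn f (Function.update ls k a)) fun a b hab => ?_
    have := CompatC.fn (f := f) (ls := Function.update ls k a) (k := k) (l' := b)
      (by simpa using hab)
    simpa using this
  have key : ∀ s : Finset (Fin (arity f)),
      LevelConv T (.fn f ls) (.fn f fun k => if k ∈ s then ls' k else ls k) := by
    intro s
    induction s using Finset.induction_on with
    | empty => simpa using refl _
    | insert a s ha ih =>
      refine ih.trans ?_
      have := hup (fun k => if k ∈ s then ls' k else ls k) a (h a)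
      convert this using 2
      · funext k
        by_cases hk : k = a
        · subst hk; simp [ha]
        · simp [hk]
      · funext k
        by_cases hk : k = a
        · subst hk; simp
        · simp [hk]
  simpa using key Finset.univ

theorem subst {l l' : Level} (h : LevelConv T l l') {τ τ' : ℕ → Level}
    (hτ : ∀ n, LevelConv T (τ n) (τ' n)) : LevelConv T (l.subst τ) (l'.subst τ') := by
  refine (h.map (f := CTerm.subst τ) fun _ _ h => h.subst fun _ _ h => h.subst τ).trans ?_
  clear h
  induction l' with
  | ivar n => exact hτ n
  | fn f ls ih => exact fn ih

end LevelConv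

namespace Par

@[refl]
theorem refl (t : Trm L) : Par T t t := by
  induction t with
  | var n => exact .var n
  | const c => exact .const c
  | sort s => exact .sort s
  | pi _ _ h h' => exact .pi h h'
  | abs _ h => exact .abs h
  | app _ _ h h' => exact .app h h'
  | piC _ _ h h' => exact .piC h h'
  | absC _ h => exact .absC h
  | appC _ l h => exact .appC h (.refl l)

/-- Parallel reduction is preserved by every class of pairs of pointwise related substitutions that
is closed under lifting. -/
theorem subst_of_class (hT : T.ClosedBodies)
    {S : (ℕ → Trm L) → (ℕ → Trm L) → (ℕ → Level) → (ℕ → Level) → Prop}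
    (hS : ∀ {σ σ' τ τ'}, S σ σ' τ τ' → (∀ n, Par T (σ n) (σ' n)) ∧ ∀ n, LevelConv T (τ n) (τ' n))
    (hup : ∀ {σ σ' τ τ'}, S σ σ' τ τ' → S (up σ) (up σ') τ τ')
    (hupC : ∀ {σ σ' τ τ'}, S σ σ' τ τ' → S (upShiftC σ) (upShiftC σ') (upC τ) (upC τ'))
    {t t' : Trm L} (h : Par T t t') {σ σ' τ τ'} (hs : S σ σ' τ τ') :
    Par T (t.subst σ τ) (t'.subst σ' τ') := by
  induction h generalizing σ σ' τ τ' with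
  | var n => exact (hS hs).1 n
  | const c => exact .const c
  | sort s => exact .sort s
  | pi _ _ h h' => exact .pi (h hs) (h' (hup hs))
  | abs _ h => exact .abs (h (hup hs))
  | app _ _ h h' => exact .app (h hs) (h' hs)
  | piC _ _ h h' => exact .piC (h hs) (h' (hupC hs))
  | absC _ h => exact .absC (h (hupC hs))
  | appC _ hl h => exact .appC (h hs) (hl.subst (hS hs).2)
  | beta _ _ h h' => rw [Term.inst_subst]; exact .beta (h (hup hs)) (h' hs)
  | betaC _ hl h => rw [Term.instC_subst]; exact .betaC (h (hupC hs)) (hl.subst (hS hs).2)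
  | delta h => rw [hT _ _ _ h]; exact .delta h
  | tmU hl => exact .tmU (hl.subst (hS hs).2)
  | appLam _ _ h h' => exact .appLam (h hs) (h' hs)

/-- Pairs of equal substitutions are trivially closed under lifting. The case of weakening is then
what makes pairs of related substitutions closed under lifting. -/
theorem subst_left (hT : T.ClosedBodies) {t t' : Trm L} (h : Par T t t') (σ : ℕ → Trm L)
    (τ : ℕ → Level) : Par T (t.subst σ τ) (t'.subst σ τ) :=
  h.subst_of_class hT (S := fun σ σ' τ τ' => σ = σ' ∧ τ = τ')
    (by rintro _ _ _ _ ⟨rfl, rfl⟩; exact ⟨fun _ => refl _, fun _ => .refl _⟩)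
    (by rintro _ _ _ _ ⟨rfl, rfl⟩; exact ⟨rfl, rfl⟩)
    (by rintro _ _ _ _ ⟨rfl, rfl⟩; exact ⟨rfl, rfl⟩) ⟨rfl, rfl⟩

theorem subst (hT : T.ClosedBodies) {t t' : Trm L} (h : Par T t t') {σ σ' : ℕ → Trm L}
    {τ τ' : ℕ → Level} (hσ : ∀ n, Par T (σ n) (σ' n)) (hτ : ∀ n, LevelConv T (τ n) (τ' n)) :
    Par T (t.subst σ τ) (t'.subst σ' τ') := by
  refine h.subst_of_class hT (S := fun σ σ' τ τ' =>
    (∀ n, Par T (σ n) (σ' n)) ∧ ∀ n, LevelConv T (τ n) (τ' n)) id ?_ ?_ ⟨hσ, hτ⟩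
  · rintro _ _ _ _ ⟨hσ, hτ⟩
    refine ⟨fun n => ?_, hτ⟩
    cases n
    · exact .var 0
    · simp only [up, scons, Term.shift_eq_subst]
      exact (hσ _).subst_left hT _ _
  · rintro _ _ _ _ ⟨hσ, hτ⟩
    refine ⟨fun n => ?_, fun n => ?_⟩
    · simp only [upShiftC, Term.shiftC_eq_subst]
      exact (hσ _).subst_left hT _ _
    · cases n
      · exact .refl _
      · simp only [upC, scons, CTerm.shiftC, CTerm.rename_eq_subst]
        exact (hτ _).subst fun _ => .refl _

theorem inst (hT : T.ClosedBodies) {t t' u u' : Trm L} (h : Par T t t') (h' : Par T u u') :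
    Par T (t.inst u) (t'.inst u') :=
  h.subst hT (fun n => by cases n; exacts [h', .var _]) fun _ => .refl _

theorem instC (hT : T.ClosedBodies) {t t' : Trm L} {l l' : Level} (h : Par T t t')
    (h' : LevelConv T l l') : Par T (t.instC l) (t'.instC l') :=
  h.subst hT (fun _ => .var _) fun n => by cases n; exacts [h', .refl _]

theorem of_compat (hrules : T.rules ⊆ {ruleU L, ruleBeta L}) {t t' : Trm L}
    (h : Compat T.RootStep T.EqRoot t t') : Par T t t' := by
  induction h with
  | root h =>
    rcases h with ⟨t, u⟩ | ⟨t, l⟩ | ⟨hr, σ, τ⟩ | @⟨c, A, t, h⟩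
    · exact .beta (refl _) (refl _)
    · exact .betaC (refl _) (.refl _)
    · rcases hrules hr with rfl | rfl
      · exact .tmU (.refl _)
      · exact .appLam (refl _) (refl _)
    · exact .delta h
  | piL _ h => exact .pi h (refl _)
  | piR _ h => exact .pi (refl _) h
  | abs _ h => exact .abs h
  | appL _ h => exact .app h (refl _)
  | appR _ h => exact .app (refl _) h
  | piCL _ h => exact .piC h (refl _)
  | piCR _ h => exact .piC (refl _) h
  | absC _ h => exact .absC h
  | appCL _ h => exact .appC h (.refl _)
  | appCR h => exact .appC (refl _) (EqvGen.rel _ _ h)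

/-! ## Confluence -/

/-- This lemma and the next four show that certain spines are rigid: without a definition for the
head, and with too few or the wrong arguments for a rule, a step can only act inside the arguments.
-/
theorem const_inv {c : Const L} (hc : Undefined T c) {x : Trm L} (h : Par T (.const c) x) :
    x = .const c := by
  cases h with
  | const => rfl
  | delta h => exact (hc _ _ h).elim

theorem appC_const_inv {c : Const L} (hc : Undefined T c) {l : Level} {x : Trm L}
    (h : Par T (.appC (.const c) l) x) : ∃ l', x = .appC (.const c) l' ∧ LevelConv T l l' := by
  cases h with
  | appC h hl => exact ⟨_, by rw [const_inv hc h], hl⟩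

theorem appC_appC_const_inv {c : Const L} (hc : Undefined T c) {l k : Level} {x : Trm L}
    (h : Par T (.appC (.appC (.const c) l) k) x) :
    ∃ l' k', x = .appC (.appC (.const c) l') k' ∧ LevelConv T l l' ∧ LevelConv T k k' := by
  cases h with
  | appC h hl =>
    obtain ⟨l', rfl, hl'⟩ := appC_const_inv hc h
    exact ⟨_, _, rfl, hl', hl⟩

theorem app_app_const_inv {c : Const L} (hc : Undefined T c) {l k : Level} {A B x : Trm L}
    (h : Par T (.app (.app (.appC (.appC (.const c) l) k) A) B) x) :
    ∃ l' k' A' B', x = .app (.app (.appC (.appC (.const c) l') k') A') B' ∧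
      LevelConv T l l' ∧ LevelConv T k k' ∧ Par T A A' ∧ Par T B B' := by
  cases h with
  | app h hB =>
    cases h with
    | app h hA =>
      obtain ⟨l', k', rfl, hl, hk⟩ := appC_appC_const_inv hc h
      exact ⟨_, _, _, _, rfl, hl, hk, hA, hB⟩

theorem app_app_app_const_inv {c : Const L} (hc : Undefined T c) {l k : Level} {A B t x : Trm L}
    (h : Par T (.app (.app (.app (.appC (.appC (.const c) l) k) A) B) t) x) :
    ∃ l' k' A' B' t', x = .app (.app (.app (.appC (.appC (.const c) l') k') A') B') t' ∧
      Par T t t' := by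
  cases h with
  | app h ht =>
    obtain ⟨_, _, _, _, rfl, -⟩ := app_app_const_inv hc h
    exact ⟨_, _, _, _, _, rfl, ht⟩

/-- A redex contracted on one side survives on the other and is contracted there. `Undefined`
excludes unfolding a constant of a pattern, and uniqueness of bodies closes the pair of two `δ`
steps. Levels never obstruct: `LevelConv` is symmetric, so one side keeps its level and the other
moves to it. -/
theorem diamond (hT : T.ClosedBodies)
    (hδ : ∀ c A t A' t', Decl.defn c A t ∈ T.sig → Decl.defn c A' t' ∈ T.sig → t = t')
    (hTm : Undefined T .Tm) (hU : Undefined T .U) (hLam : Undefined T .Lam)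
    (hApp : Undefined T .App) {t u₁ u₂ : Trm L} (h₁ : Par T t u₁) (h₂ : Par T t u₂) :
    ∃ v, Par T u₁ v ∧ Par T u₂ v := by
  induction h₁ generalizing u₂ with
  | var n => exact ⟨_, h₂, refl _⟩
  | const c => exact ⟨_, h₂, refl _⟩
  | sort s => exact ⟨_, h₂, refl _⟩
  | pi _ _ ih ih' =>
    cases h₂ with
    | pi h h' =>
      obtain ⟨v, h1, h2⟩ := ih h
      obtain ⟨v', h1', h2'⟩ := ih' h'
      exact ⟨_, .pi h1 h1', .pi h2 h2'⟩
  | abs _ ih =>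
    cases h₂ with
    | abs h =>
      obtain ⟨v, h1, h2⟩ := ih h
      exact ⟨_, .abs h1, .abs h2⟩
  | piC _ _ ih ih' =>
    cases h₂ with
    | piC h h' =>
      obtain ⟨v, h1, h2⟩ := ih h
      obtain ⟨v', h1', h2'⟩ := ih' h'
      exact ⟨_, .piC h1 h1', .piC h2 h2'⟩
  | absC _ ih =>
    cases h₂ with
    | absC h =>
      obtain ⟨v, h1, h2⟩ := ih h
      exact ⟨_, .absC h1, .absC h2⟩
  | app ht hu ih ih' =>
    cases h₂ with
    | app h h' =>
      obtain ⟨v, h1, h2⟩ := ih h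
      obtain ⟨v', h1', h2'⟩ := ih' h'
      exact ⟨_, .app h1 h1', .app h2 h2'⟩
    | beta h h' =>
      obtain ⟨v, h1, h2⟩ := ih (.abs h)
      obtain ⟨v', h1', h2'⟩ := ih' h'
      cases ht with
      | abs ht =>
        cases h2 with
        | abs h2 =>
          cases h1 with
          | abs h1 => exact ⟨_, .beta h1 h1', h2.inst hT h2'⟩
    | tmU h =>
      obtain ⟨k', rfl, hk⟩ := appC_const_inv hTm ht
      obtain ⟨l', rfl, hl⟩ := appC_const_inv hU hu
      exact ⟨_, .tmU (.refl _), .appC (.const _) (h.symm.trans hl)⟩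
    | @appLam l l' k k' A B A' B' t t' _ u' h h' =>
      -- The induction hypothesis concerns the whole function part `@ l l' A B (λ … t)`, so the step
      -- on `t` is first extended to it by reflexivity. Rigidity of the spines then extracts the
      -- join of the two reducts of `t`.
      obtain ⟨v, h1, h2⟩ := ih (.app (refl _) (.app (refl _) h))
      obtain ⟨v', h1', h2'⟩ := ih' h'
      obtain ⟨_, _, _, _, _, rfl, h3⟩ := app_app_app_const_inv hApp ht
      obtain ⟨_, _, _, _, _, rfl, -⟩ := app_app_app_const_inv hLam h3
      obtain ⟨_, _, _, _, _, rfl, h4⟩ := app_app_app_const_inv hApp h1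
      obtain ⟨_, _, _, _, _, rfl, h5⟩ := app_app_app_const_inv hLam h4
      cases h2 with
      | app _ h2 =>
        cases h2 with
        | app _ h2 => exact ⟨_, .appLam h5 h1', .app h2 h2'⟩
  | appC ht hl ih =>
    cases h₂ with
    | appC h h' =>
      obtain ⟨v, h1, h2⟩ := ih h
      exact ⟨_, .appC h1 (hl.symm.trans h'), .appC h2 (.refl _)⟩
    | betaC h h' =>
      obtain ⟨v, h1, h2⟩ := ih (.absC h)
      cases ht with
      | absC ht =>
        cases h2 with
        | absC h2 =>
          cases h1 with
          | absC h1 => exact ⟨_, .betaC h1 (hl.symm.trans h'), h2.instC hT (.refl _)⟩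
  | beta ht hu ih ih' =>
    cases h₂ with
    | app h h' =>
      obtain ⟨v', h1', h2'⟩ := ih' h'
      cases h with
      | abs h =>
        obtain ⟨v, h1, h2⟩ := ih h
        exact ⟨_, h1.inst hT h1', .beta h2 h2'⟩
    | beta h h' =>
      obtain ⟨v, h1, h2⟩ := ih h
      obtain ⟨v', h1', h2'⟩ := ih' h'
      exact ⟨_, h1.inst hT h1', h2.inst hT h2'⟩
  | betaC ht hl ih =>
    cases h₂ with
    | appC h h' =>
      cases h with
      | absC h =>
        obtain ⟨v, h1, h2⟩ := ih h
        exact ⟨_, h1.instC hT (hl.symm.trans h'), .betaC h2 (.refl _)⟩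
    | betaC h h' =>
      obtain ⟨v, h1, h2⟩ := ih h
      exact ⟨_, h1.instC hT (hl.symm.trans h'), h2.instC hT (.refl _)⟩
  | delta h =>
    cases h₂ with
    | const => exact ⟨_, refl _, .delta h⟩
    | delta h' => exact ⟨_, refl _, hδ _ _ _ _ _ h' h ▸ refl _⟩
  | tmU h =>
    cases h₂ with
    | app ht hu =>
      obtain ⟨k', rfl, hk⟩ := appC_const_inv hTm ht
      obtain ⟨l', rfl, hl⟩ := appC_const_inv hU hu
      exact ⟨_, .appC (.const _) (h.symm.trans hl), .tmU (.refl _)⟩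
    | tmU h' => exact ⟨_, .appC (.const _) (h.symm.trans h'), refl _⟩
  | appLam ht hu ih ih' =>
    cases h₂ with
    | app h h' =>
      obtain ⟨v', h1', h2'⟩ := ih' h'
      obtain ⟨_, _, _, _, _, rfl, h3⟩ := app_app_app_const_inv hApp h
      obtain ⟨_, _, _, _, _, rfl, h4⟩ := app_app_app_const_inv hLam h3
      obtain ⟨v, h1, h2⟩ := ih h4
      exact ⟨_, .app h1 h1', .appLam h2 h2'⟩
    | appLam h h' =>
      obtain ⟨v, h1, h2⟩ := ih h
      obtain ⟨v', h1', h2'⟩ := ih' h'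
      exact ⟨_, .app h1 h1', .app h2 h2'⟩

end Par

/-! ## Extensions of UPP by a local signature -/

/-- The theory UPP extended by the local signature `Φ`. -/
abbrev withLocal (Φ : List (Decl (Const L) arity)) : Theory (Const L) arity := (theory L).extend Φ

variable {Φ : List (Decl (Const L) arity)}

theorem mem_withLocal {d : Decl (Const L) arity} (h : d ∈ sig L) : d ∈ (withLocal Φ).sig :=
  List.mem_append_left _ h

/-- The three confined constants are all declared by UPP itself, so the signature imposes no
condition on levels and `LevelConv` may ignore it. -/
theorem level_over (l : Level) : l.Over (DeclaredInC (withLocal Φ).sig) := by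
  induction l with
  | ivar n => trivial
  | fn f ls ih =>
    refine ⟨?_, ih⟩
    cases f <;> simp [DeclaredInC, Theory.extend, theory, sig, Decl.name]

theorem declaredIn {c : Const L} {A : Trm L} (h : Decl.const c A ∈ sig L) :
    DeclaredIn (withLocal Φ).sig c :=
  List.mem_map_of_mem (f := Decl.name) (mem_withLocal h)

section WellFormed

variable (hΦ : (theory L).IsLocalSignature Φ)
include hΦ

theorem decl_unique {d d' : Decl (Const L) arity} (hd : d ∈ (withLocal Φ).sig)
    (hd' : d' ∈ (withLocal Φ).sig) (h : d.name = d'.name) : d = d' :=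
  List.inj_on_of_nodup_map hΦ.2.1 hd hd' h

theorem declares_unique {c : Const L} {A A' : Trm L} (h : Declares (withLocal Φ) c A)
    (h' : Declares (withLocal Φ) c A') : A = A' := by
  rcases h with h | ⟨t, h⟩ <;> rcases h' with h' | ⟨t', h'⟩ <;>
    have := decl_unique hΦ h h' rfl <;> simp_all

theorem undefined {c : Const L} {A : Trm L} (h : Decl.const c A ∈ sig L) :
    Undefined (withLocal Φ) c := by
  intro A' t h'
  have := decl_unique hΦ (mem_withLocal h) h' rfl
  simp at this

theorem wellTyped : WellTyped (withLocal Φ) := by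
  refine hΦ.2.wellTyped fun S S' hS f Δ A hf => ⟨.Lvl, ?_, ?_⟩
  · cases S with
    | nil => simp at hf
    | cons d S =>
      -- A nonempty prefix begins with the declaration of `Lvl`, the first entry of the signature.
      have hd : Decl.const .Lvl type = d := (List.cons.inj hS).1
      exact hd ▸ List.mem_cons_self
  · have hmem : Decl.conf f Δ A ∈ sig L ++ Φ := by
      rw [show sig L ++ Φ = S ++ S' from hS]
      exact List.mem_append_left S' hf
    rcases List.mem_append.1 hmem with h | h
    · simp only [sig, List.mem_cons, List.not_mem_nil, or_false, reduceCtorEq, false_or] at h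
      rcases h with h | h | h <;> cases h <;> exact ⟨rfl, fun _ => rfl⟩
    · exact (hΦ.1 _ h trivial).elim

theorem closedBodies : (withLocal Φ).ClosedBodies := (wellTyped hΦ).closedBodies

theorem par_diamond {t u₁ u₂ : Trm L} (h₁ : Par (withLocal Φ) t u₁)
    (h₂ : Par (withLocal Φ) t u₂) : ∃ v, Par (withLocal Φ) u₁ v ∧ Par (withLocal Φ) u₂ v := by
  refine Par.diamond (closedBodies hΦ) (fun c A t A' t' h h' => ?_)
    (undefined hΦ (A := tmType) ?_) (undefined hΦ (A := uType) ?_)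
    (undefined hΦ (A := lamType) ?_) (undefined hΦ (A := appType) ?_) h₁ h₂
  · have := decl_unique hΦ h h' rfl
    simp_all
  all_goals simp [sig]

omit hΦ in
theorem conv_par {t u : Trm L} (h : (withLocal Φ).ConvStep t u) : Par (withLocal Φ) t u :=
  .of_compat (fun _ h => h) h.2.2

/-- Convertible terms have a common reduct. -/
theorem conv_join {t u : Trm L} (h : (withLocal Φ).Conv t u) :
    Join (ReflTransGen (Par (withLocal Φ))) t u := by
  have heq := equivalence_join_reflTransGen (r := Par (withLocal Φ)) fun a b c hb hc => by
    obtain ⟨v, h1, h2⟩ := par_diamond hΦ hb hc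
    exact ⟨v, .single h1, .single h2⟩
  rw [Theory.conv_iff] at h
  induction h with
  | refl t => exact heq.refl t
  | rel t u h => exact ⟨u, .single (conv_par h), .refl⟩
  | symm _ _ _ ih => exact heq.symm ih
  | trans _ _ _ _ _ ih ih' => exact heq.trans ih ih'

omit hΦ in
theorem conv_appC {t t' : Trm L} {l l' : Level} (h : (withLocal Φ).Conv t t')
    (hl : LevelConv (withLocal Φ) l l') (ht : t'.OverSig (withLocal Φ).sig) :
    (withLocal Φ).Conv (.appC t l) (.appC t' l') :=
  (h.appC_left (level_over l)).trans (.appC_right hl ht level_over)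

/-- Confluence produces a common reduct by raw steps, while conversion lives over the signature.
Hence each step must be shown to stay there: bodies of definitions are typed, and levels are always
admissible. Inner steps are performed first and the root redex is contracted afterwards. -/
theorem Par.conv {t t' : Trm L} (h : Par (withLocal Φ) t t') (ht : t.OverSig (withLocal Φ).sig) :
    t'.OverSig (withLocal Φ).sig ∧ (withLocal Φ).Conv t t' := by
  induction h with
  | var n => exact ⟨trivial, .refl _⟩
  | const c => exact ⟨ht, .refl _⟩
  | sort s => exact ⟨trivial, .refl _⟩
  | pi _ _ ih ih' =>
    obtain ⟨ho, hc⟩ := ih ht.1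
    obtain ⟨ho', hc'⟩ := ih' ht.2
    exact ⟨⟨ho, ho'⟩, hc.pi hc' ho ht.2⟩
  | piC _ _ ih ih' =>
    obtain ⟨ho, hc⟩ := ih ht.1
    obtain ⟨ho', hc'⟩ := ih' ht.2
    exact ⟨⟨ho, ho'⟩, hc.piC hc' ho ht.2⟩
  | app _ _ ih ih' =>
    obtain ⟨ho, hc⟩ := ih ht.1
    obtain ⟨ho', hc'⟩ := ih' ht.2
    exact ⟨⟨ho, ho'⟩, hc.app hc' ho ht.2⟩
  | abs _ ih => exact ⟨(ih ht).1, (ih ht).2.abs⟩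
  | absC _ ih => exact ⟨(ih ht).1, (ih ht).2.absC⟩
  | appC _ hl ih =>
    obtain ⟨ho, hc⟩ := ih ht.1
    exact ⟨⟨ho, level_over _⟩, conv_appC hc hl ho⟩
  | beta _ _ ih ih' =>
    obtain ⟨ho, hc⟩ := ih ht.1
    obtain ⟨ho', hc'⟩ := ih' ht.2
    exact ⟨ho.inst ho', (hc.abs.app hc' ho ht.2).trans
      (.of_rootStep ⟨ho, ho'⟩ (ho.inst ho') (.inl (.mk _ _)))⟩
  | betaC _ hl ih =>
    obtain ⟨ho, hc⟩ := ih ht.1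
    exact ⟨ho.instC (level_over _), (conv_appC hc.absC hl ho).trans
      (.of_rootStep ⟨ho, level_over _⟩ (ho.instC (level_over _)) (.inr (.inl (.mk _ _))))⟩
  | delta h =>
    have ho := ((wellTyped hΦ).defn _ _ _ h).overSig
    exact ⟨ho, .of_rootStep ht ho (.inr (.inr (.inr (.mk h))))⟩
  | @tmU k l l' hl =>
    have hTy : (Term.const .Ty : Trm L).Over (DeclaredIn (withLocal Φ).sig)
        (DeclaredInC (withLocal Φ).sig) := declaredIn (c := .Ty) (A := tyType) (by simp [sig])
    refine ⟨⟨hTy, level_over _⟩, .trans (.of_rootStep ht (u := .appC (.const .Ty) l)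
      ⟨hTy, level_over _⟩ (.inr (.inr (.inl ?_)))) (conv_appC (.refl _) hl hTy)⟩
    -- In this rule, index `0` is the level of `U` and index `1` the level of `Tm`.
    exact .mk (r := ruleU L) (Set.mem_insert _ _) .var (scons l (scons k .ivar))
  | @appLam l l' k k' A B A' B' t t' u u' _ _ ih ih' =>
    obtain ⟨ho, hc⟩ := ih ht.1.2.2
    obtain ⟨ho', hc'⟩ := ih' ht.2
    refine ⟨⟨ho, ho'⟩, .trans (.of_rootStep ht (u := .app t u) ⟨ht.1.2.2, ht.2⟩
      (.inr (.inr (.inl ?_)))) (hc.app hc' ho ht.2)⟩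
    exact .mk (r := ruleBeta L) (Set.mem_insert_of_mem _ rfl)
      (scons A (scons B (scons A' (scons B' (scons t (scons u .var))))))
      (scons l (scons l' (scons k (scons k' .ivar))))

theorem conv_of_reflTransGen {t t' : Trm L} (h : ReflTransGen (Par (withLocal Φ)) t t')
    (ht : t.OverSig (withLocal Φ).sig) :
    t'.OverSig (withLocal Φ).sig ∧ (withLocal Φ).Conv t t' := by
  induction h with
  | refl => exact ⟨ht, .refl _⟩
  | tail _ h ih =>
    obtain ⟨ho, hc⟩ := Par.conv hΦ h ih.1
    exact ⟨ho, ih.2.trans hc⟩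

theorem conv_of_join {t u v : Trm L} (h : ReflTransGen (Par (withLocal Φ)) t v)
    (h' : ReflTransGen (Par (withLocal Φ)) u v) (ht : t.OverSig (withLocal Φ).sig)
    (hu : u.OverSig (withLocal Φ).sig) : (withLocal Φ).Conv t u :=
  (conv_of_reflTransGen hΦ h ht).2.trans (conv_of_reflTransGen hΦ h' hu).2.symm

/-! ## Injectivity of type formers -/

/-- No root step applies to a product, so its reducts are products reduced componentwise. The
components of a common reduct link those of the two given products. -/
theorem conv_pi_inj {A B A' B' : Trm L} (h : (withLocal Φ).Conv (.pi A B) (.pi A' B'))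
    (ho : (Term.pi A B).OverSig (withLocal Φ).sig)
    (ho' : (Term.pi A' B').OverSig (withLocal Φ).sig) :
    (withLocal Φ).Conv A A' ∧ (withLocal Φ).Conv B B' := by
  have key : ∀ {A B x : Trm L}, ReflTransGen (Par (withLocal Φ)) (.pi A B) x →
      ∃ A' B', x = .pi A' B' ∧ ReflTransGen (Par (withLocal Φ)) A A' ∧
        ReflTransGen (Par (withLocal Φ)) B B' := by
    intro A B x h
    induction h with
    | refl => exact ⟨_, _, rfl, .refl, .refl⟩
    | tail _ h ih =>
      obtain ⟨A', B', rfl, hA, hB⟩ := ih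
      cases h with
      | pi h h' => exact ⟨_, _, rfl, hA.tail h, hB.tail h'⟩
  obtain ⟨v, h1, h2⟩ := conv_join hΦ h
  obtain ⟨A₁, B₁, rfl, hA, hB⟩ := key h1
  obtain ⟨A₂, B₂, h, hA', hB'⟩ := key h2
  cases h
  exact ⟨conv_of_join hΦ hA hA' ho.1 ho'.1, conv_of_join hΦ hB hB' ho.2 ho'.2⟩

theorem conv_piC_inj {A B A' B' : Trm L} (h : (withLocal Φ).Conv (.piC A B) (.piC A' B'))
    (ho : (Term.piC A B).OverSig (withLocal Φ).sig)
    (ho' : (Term.piC A' B').OverSig (withLocal Φ).sig) :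
    (withLocal Φ).Conv A A' ∧ (withLocal Φ).Conv B B' := by
  have key : ∀ {A B x : Trm L}, ReflTransGen (Par (withLocal Φ)) (.piC A B) x →
      ∃ A' B', x = .piC A' B' ∧ ReflTransGen (Par (withLocal Φ)) A A' ∧
        ReflTransGen (Par (withLocal Φ)) B B' := by
    intro A B x h
    induction h with
    | refl => exact ⟨_, _, rfl, .refl, .refl⟩
    | tail _ h ih =>
      obtain ⟨A', B', rfl, hA, hB⟩ := ih
      cases h with
      | piC h h' => exact ⟨_, _, rfl, hA.tail h, hB.tail h'⟩
  obtain ⟨v, h1, h2⟩ := conv_join hΦ h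
  obtain ⟨A₁, B₁, rfl, hA, hB⟩ := key h1
  obtain ⟨A₂, B₂, h, hA', hB'⟩ := key h2
  cases h
  exact ⟨conv_of_join hΦ hA hA' ho.1 ho'.1, conv_of_join hΦ hB hB' ho.2 ho'.2⟩

/-- The rule for `Tm` fires only on a code `U l`, and `Π` heads neither a rule nor a definition, so
the whole spine is rigid. The outer levels are not compared, as the retyping of the contractum does
not need them. -/
theorem conv_tm_pi_inj {m l k m' l' k' : Level} {A B A' B' : Trm L}
    (h : (withLocal Φ).Conv (Tm m (Pi l k A B)) (Tm m' (Pi l' k' A' B')))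
    (ho : (Pi l k A B).OverSig (withLocal Φ).sig)
    (ho' : (Pi l' k' A' B').OverSig (withLocal Φ).sig) :
    LevelConv (withLocal Φ) l l' ∧ LevelConv (withLocal Φ) k k' ∧ (withLocal Φ).Conv A A' ∧
      (withLocal Φ).Conv B B' := by
  have hPi : Undefined (withLocal Φ) .Pi := undefined hΦ (A := piType) (by simp [sig])
  have hTm : Undefined (withLocal Φ) .Tm := undefined hΦ (A := tmType) (by simp [sig])
  have key : ∀ {m l k : Level} {A B x : Trm L},
      ReflTransGen (Par (withLocal Φ)) (Tm m (Pi l k A B)) x →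
      ∃ m' l' k' A' B', x = Tm m' (Pi l' k' A' B') ∧ LevelConv (withLocal Φ) l l' ∧
        LevelConv (withLocal Φ) k k' ∧ ReflTransGen (Par (withLocal Φ)) A A' ∧
        ReflTransGen (Par (withLocal Φ)) B B' := by
    intro m l k A B x h
    induction h with
    | refl => exact ⟨_, _, _, _, _, rfl, .refl _, .refl _, .refl, .refl⟩
    | tail _ h ih =>
      obtain ⟨m', l', k', A', B', rfl, hl, hk, hA, hB⟩ := ih
      unfold Tm Pi at h
      cases h with
      | app h h' =>
        obtain ⟨m₁, rfl, -⟩ := Par.appC_const_inv hTm h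
        obtain ⟨l₁, k₁, A₁, B₁, rfl, hl', hk', hA', hB'⟩ := Par.app_app_const_inv hPi h'
        exact ⟨_, _, _, _, _, rfl, hl.trans hl', hk.trans hk', hA.tail hA', hB.tail hB'⟩
  obtain ⟨v, h1, h2⟩ := conv_join hΦ h
  obtain ⟨m₁, l₁, k₁, A₁, B₁, rfl, hl, hk, hA, hB⟩ := key h1
  obtain ⟨m₂, l₂, k₂, A₂, B₂, h, hl', hk', hA', hB'⟩ := key h2
  simp only [Tm, Pi, Term.app.injEq, Term.appC.injEq, true_and] at h
  obtain ⟨-, ⟨⟨rfl, rfl⟩, rfl⟩, rfl⟩ := h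
  exact ⟨hl.trans hl'.symm, hk.trans hk'.symm, conv_of_join hΦ hA hA' ho.1.2 ho'.1.2,
    conv_of_join hΦ hB hB' ho.2 ho'.2⟩

/-! ## Principal types -/

omit hΦ in
/-- `A` is a type of `t`, and every type of `t` is obtained from it by conversion. -/
def Principal (Φ : List (Decl (Const L) arity)) (Γ : Ctx (Const L) arity) (t A : Trm L) : Prop :=
  HasType (withLocal Φ) Γ t A ∧
    ∀ D, HasType (withLocal Φ) Γ t D → ConvType (withLocal Φ) Γ A D

variable {Γ : Ctx (Const L) arity} {t u A B D : Trm L} {l : Level}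

/-- The identity substitution is displayed on purpose: it starts the accumulation of arguments in
`Principal.app` and `Principal.appC`. -/
theorem principal_const {c : Const L} (hΓ : WfCtx (withLocal Φ) Γ) (h : Decl.const c A ∈ sig L) :
    Principal Φ Γ (.const c) (A.subst .var .ivar) := by
  rw [Term.subst_id]
  refine ⟨.const hΓ (mem_withLocal h), fun D hD => ?_⟩
  obtain ⟨A', hA', hD⟩ := hD.const_inv
  exact declares_unique hΦ (.inl (mem_withLocal h)) hA' ▸ hD

/-- Inversion yields some product type for the head, and injectivity matches it with the principal
one. The type is kept as a telescope under a substitution that grows by `scons`, so a constant can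
be followed through its arguments without normalising types. -/
theorem Principal.app {σ : ℕ → Trm L} {τ : ℕ → Level}
    (ht : Principal Φ Γ t ((Term.pi A B).subst σ τ))
    (h : HasType (withLocal Φ) Γ (.app t u) D) :
    HasType (withLocal Φ) Γ u (A.subst σ τ) ∧
      Principal Φ Γ (.app t u) (B.subst (scons u σ) τ) := by
  have hT := wellTyped hΦ
  have heq : (B.subst (up σ) τ).inst u = B.subst (scons u σ) τ := by
    simp only [Term.inst, Term.subst_subst]
    congr 1
    · funext n
      cases n
      · rfl
      · exact Term.shift_inst _ _
    · funext n; exact CTerm.subst_ivar _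
  obtain ⟨s, hA, hB⟩ := ht.1.isType_pi hT
  have key : ∀ {D}, HasType (withLocal Φ) Γ (.app t u) D →
      HasType (withLocal Φ) Γ u (A.subst σ τ) ∧
        ConvType (withLocal Φ) Γ (B.subst (scons u σ) τ) D := by
    intro D h
    obtain ⟨A', B', ht', hu, hD⟩ := h.app_inv
    obtain ⟨s', hA', hB'⟩ := ht'.isType_pi hT
    obtain ⟨h1, h2⟩ := conv_pi_inj hΦ (ht.2 _ ht').conv (ht.1.overSig_right hT)
      (ht'.overSig_right hT)
    refine ⟨.conv hu hA h1.symm, .trans (.inr ⟨?_, _, hB'.inst hT hu⟩) hD⟩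
    rw [← heq]
    exact h2.inst hT.closedBodies hu.overSig
  exact ⟨(key h).1, heq ▸ ht.1.app (key h).1, fun D h => (key h).2⟩

theorem Principal.appC {σ : ℕ → Trm L} {τ : ℕ → Level}
    (ht : Principal Φ Γ t ((Term.piC A B).subst σ τ))
    (h : HasType (withLocal Φ) Γ (.appC t l) D) :
    HasTypeC (withLocal Φ) Γ l (A.subst σ τ) ∧
      Principal Φ Γ (.appC t l) (B.subst σ (scons l τ)) := by
  have hT := wellTyped hΦ
  have heq : (B.subst (upShiftC σ) (upC τ)).instC l = B.subst σ (scons l τ) := by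
    simp only [Term.instC, Term.subst_subst]
    congr 1
    · funext n; exact Term.shiftC_instC _ _
    · funext n
      cases n
      · rfl
      · simp only [upC, scons, CTerm.shiftC, CTerm.subst_rename]
        exact CTerm.subst_ivar _
  obtain ⟨s, hA, hB⟩ := ht.1.isType_piC hT
  have key : ∀ {D}, HasType (withLocal Φ) Γ (.appC t l) D →
      HasTypeC (withLocal Φ) Γ l (A.subst σ τ) ∧
        ConvType (withLocal Φ) Γ (B.subst σ (scons l τ)) D := by
    intro D h
    obtain ⟨A', B', ht', hl, hD⟩ := h.appC_inv
    obtain ⟨s', hA', hB'⟩ := ht'.isType_piC hT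
    obtain ⟨h1, h2⟩ := conv_piC_inj hΦ (ht.2 _ ht').conv (ht.1.overSig_right hT)
      (ht'.overSig_right hT)
    refine ⟨.conv hl hA h1.symm, .trans (.inr ⟨?_, _, hB'.instC hT hl⟩) hD⟩
    rw [← heq]
    exact h2.instC hT.closedBodies hl.over
  exact ⟨(key h).1, heq ▸ ht.1.appC (key h).1, fun D h => (key h).2⟩

theorem principal_tm {k : Level} (h : HasType (withLocal Φ) Γ (Tm k A) D) :
    HasType (withLocal Φ) Γ A (Ty k) ∧ Principal Φ Γ (Tm k A) type := by
  obtain ⟨_, _, h', -, -⟩ := h.app_inv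
  have p := principal_const hΦ (c := .Tm) (A := tmType) h.wfCtx (by simp [sig])
  exact (p.appC hΦ h').2.app hΦ h

/-! ## Preservation of types by the root steps -/

/-- The domain conversion lets `u` replace the bound variable of the body; the codomain conversion,
instantiated at `u`, returns to the type of the application. -/
theorem HasType.beta (h : HasType (withLocal Φ) Γ (.app (.abs t) u) D) :
    HasType (withLocal Φ) Γ (t.inst u) D := by
  have hT := wellTyped hΦ
  obtain ⟨A', B', ht', hu, hD⟩ := h.app_inv
  obtain ⟨A, B, s, hA, hB, ht, hc⟩ := ht'.abs_inv
  obtain ⟨s', hA', hB'⟩ := ht'.isType_pi hT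
  obtain ⟨h1, h2⟩ := conv_pi_inj hΦ hc.conv ⟨hA.overSig, hB.overSig⟩ (ht'.overSig_right hT)
  refine hD.hasType (.conv (ht.inst hT (.conv hu hA h1.symm)) (hB'.inst hT hu) ?_)
  exact h2.inst hT.closedBodies hu.overSig

theorem HasType.betaC (h : HasType (withLocal Φ) Γ (.appC (.absC t) l) D) :
    HasType (withLocal Φ) Γ (t.instC l) D := by
  have hT := wellTyped hΦ
  obtain ⟨A', B', ht', hl, hD⟩ := h.appC_inv
  obtain ⟨A, B, s, hA, hB, ht, hc⟩ := ht'.absC_inv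
  obtain ⟨s', hA', hB'⟩ := ht'.isType_piC hT
  obtain ⟨h1, h2⟩ := conv_piC_inj hΦ hc.conv ⟨hA.overSig, hB.overSig⟩ (ht'.overSig_right hT)
  refine hD.hasType (.conv (ht.instC hT (.conv hl hA h1.symm)) (hB'.instC hT hl) ?_)
  exact h2.instC hT.closedBodies hl.over

theorem HasType.delta {c : Const L} (hc : Decl.defn c A t ∈ (withLocal Φ).sig)
    (h : HasType (withLocal Φ) Γ (.const c) D) : HasType (withLocal Φ) Γ t D := by
  have hT := wellTyped hΦ
  obtain ⟨A', hA', hD⟩ := h.const_inv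
  have hA : Declares (withLocal Φ) c A := .inr ⟨t, hc⟩
  rw [← declares_unique hΦ hA hA'] at hD
  exact hD.hasType ((hT.defn _ _ _ hc).weaken_nil hT (hT.closed hA) h.wfCtx)

/-- Both sides have type `Type`. Typing `U l` forces `l : Lvl`, which is all that `Ty l` requires;
the levels `k` and `S l` need not be compared. -/
theorem HasType.tmU {k : Level} (h : HasType (withLocal Φ) Γ (Tm k (U l)) D) :
    HasType (withLocal Φ) Γ (Ty l) D := by
  obtain ⟨hU, hp⟩ := principal_tm hΦ h
  have hl := ((principal_const hΦ (c := .U) (A := uType) h.wfCtx (by simp [sig])).appC hΦ hU).1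
  refine (hp.2 _ h).hasType ?_
  exact HasType.appC (A := Lvl) (B := type)
    (.const h.wfCtx (mem_withLocal (d := .const .Ty tyType) (by simp [sig]))) hl

theorem HasType.appLam {l l' k k' : Level} {A' B' : Trm L}
    (h : HasType (withLocal Φ) Γ (.app (.app (.app (.app (.appC (.appC (.const .App) l) l') A) B)
      (.app (.app (.app (.appC (.appC (.const .Lam) k) k') A') B') t)) u) D) :
    HasType (withLocal Φ) Γ (.app t u) D := by
  have hT := wellTyped hΦ
  -- Following the type of `@` along its arguments gives the types expected of the `λ` term and of
  -- `u`, and a type for the whole. The level of the `λ` term's type stays existential, since it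
  -- plays no role.
  obtain ⟨hlam, hu, hp⟩ : (∃ m, HasType (withLocal Φ) Γ
        (.app (.app (.app (.appC (.appC (.const .Lam) k) k') A') B') t) (Tm m (Pi l l' A B))) ∧
      HasType (withLocal Φ) Γ u (Tm l A) ∧ ConvType (withLocal Φ) Γ (Tm l' (.app B u)) D := by
    obtain ⟨_, _, h5, -, -⟩ := h.app_inv
    obtain ⟨_, _, h4, -, -⟩ := h5.app_inv
    obtain ⟨_, _, h3, -, -⟩ := h4.app_inv
    obtain ⟨_, _, h2, -, -⟩ := h3.app_inv
    obtain ⟨_, _, h1, -, -⟩ := h2.appC_inv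
    have p := principal_const hΦ (c := .App) (A := appType) h.wfCtx (by simp [sig])
    have p := (Principal.appC hΦ p h1).2
    have p := (Principal.appC hΦ p h2).2
    have p := (Principal.app hΦ p h3).2
    have p := (Principal.app hΦ p h4).2
    obtain ⟨hlam, p⟩ := Principal.app hΦ p h5
    obtain ⟨hu, p⟩ := Principal.app hΦ p h
    exact ⟨⟨_, hlam⟩, hu, p.2 _ h⟩
  obtain ⟨m, hlam⟩ := hlam
  obtain ⟨ht, m', hc⟩ : HasType (withLocal Φ) Γ t
        (.pi (Tm k A') (Tm k' (.app B'.shift (.var 0)))) ∧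
      ∃ m', Principal Φ Γ (.app (.app (.app (.appC (.appC (.const .Lam) k) k') A') B') t)
        (Tm m' (Pi k k' A' B')) := by
    obtain ⟨_, _, h4, -, -⟩ := hlam.app_inv
    obtain ⟨_, _, h3, -, -⟩ := h4.app_inv
    obtain ⟨_, _, h2, -, -⟩ := h3.app_inv
    obtain ⟨_, _, h1, -, -⟩ := h2.appC_inv
    have p := principal_const hΦ (c := .Lam) (A := lamType) h.wfCtx (by simp [sig])
    have p := (Principal.appC hΦ p h1).2
    have p := (Principal.appC hΦ p h2).2
    have p := (Principal.app hΦ p h3).2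
    have p := (Principal.app hΦ p h4).2
    obtain ⟨ht, p⟩ := Principal.app hΦ p hlam
    exact ⟨ht, _, p⟩
  have ho := (hlam.overSig_right hT).2
  have ho' := (hc.1.overSig_right hT).2
  have hTm := (hlam.overSig_right hT).1.1
  obtain ⟨hl, hk, hA, hB⟩ := conv_tm_pi_inj hΦ (hc.2 _ hlam).conv ho' ho
  obtain ⟨s, hTmA, -⟩ := ht.isType_pi hT
  -- The function `t` expects the annotations of `λ`, while `u` is typed with those of `@`;
  -- injectivity has made the two domains convertible.
  have hu' : HasType (withLocal Φ) Γ u (Tm k A') := .conv hu hTmA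
    ((conv_appC (.refl _) hl.symm hTm).app hA.symm ⟨hTm, level_over _⟩ ho.1.2)
  have htu : HasType (withLocal Φ) Γ (.app t u) (Tm k' (.app B' u)) := by
    have := HasType.app ht hu'
    have heq : (Tm k' (.app B'.shift (.var 0)) : Trm L).inst u =
        Tm (k'.subst .ivar) (.app (B'.shift.inst u) u) := rfl
    rwa [heq, CTerm.subst_ivar, Term.shift_inst] at this
  refine ConvType.hasType ?_ htu
  have hconv : (withLocal Φ).Conv (Tm k' (.app B' u)) (Tm l' (.app B u)) :=
    (conv_appC (.refl _) hk hTm).app (hB.app (.refl _) ho.2 hu.overSig) ⟨hTm, level_over _⟩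
      ⟨ho'.2, hu.overSig⟩
  rcases hp with rfl | ⟨hp, hs⟩
  -- Without a final conversion, `D` is `Tm l' (B u)` itself. It is not `Kind`, so it has a sort and
  -- the conversion rule can target it.
  · rcases h.isType hT with h | h
    · simp [Tm] at h
    · exact .inr ⟨hconv, h⟩
  · exact .inr ⟨hconv.trans hp, hs⟩

theorem HasType.rootStep {t' : Trm L} (h : HasType (withLocal Φ) Γ t D)
    (hs : (withLocal Φ).RootStep t t') : HasType (withLocal Φ) Γ t' D := by
  rcases hs with ⟨t, u⟩ | ⟨t, l⟩ | ⟨hr, σ, τ⟩ | @⟨c, A, t, hc⟩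
  · exact HasType.beta hΦ h
  · exact HasType.betaC hΦ h
  · rcases hr with rfl | rfl
    · exact HasType.tmU hΦ h
    · exact HasType.appLam hΦ h
  · exact HasType.delta hΦ hc h

/-- Induction on the position of the redex. A step in a subterm that types depend on needs a repair:
a reduced domain changes the context of the codomain, and a reduced argument changes the type of an
application. -/
theorem subject_reduction {t' : Trm L} (hs : CtxClosure (withLocal Φ).RootStep t t')
    (h : HasType (withLocal Φ) Γ t D) : HasType (withLocal Φ) Γ t' D := by
  have hT := wellTyped hΦ
  induction hs generalizing Γ D with
  | root hs => exact HasType.rootStep hΦ h hs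
  | piL hs ih =>
    obtain ⟨s, hA, hB, hD⟩ := h.pi_inv
    have hA' := ih hA
    exact hD.hasType (.pi hA' (hB.ctx_reg hT hA hA' (.symm (.of_step hA.overSig hA'.overSig hs))))
  | piR _ ih =>
    obtain ⟨s, hA, hB, hD⟩ := h.pi_inv
    exact hD.hasType (.pi hA (ih hB))
  | abs _ ih =>
    obtain ⟨A, B, s, hA, hB, ht, hD⟩ := h.abs_inv
    exact hD.hasType (.abs hA hB (ih ht))
  | appL _ ih =>
    obtain ⟨A, B, ht, hu, hD⟩ := h.app_inv
    exact hD.hasType (.app (ih ht) hu)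
  | appR hs ih =>
    obtain ⟨A, B, ht, hu, hD⟩ := h.app_inv
    obtain ⟨s, hA, hB⟩ := ht.isType_pi hT
    have hu' := ih hu
    -- The reduced application has the type with `u'` substituted; it is converted back to the one
    -- with `u`.
    exact hD.hasType (.conv (.app ht hu') (hB.inst hT hu) (.inst_right hT.closedBodies hB.overSig
      hu'.overSig hu.overSig (.symm (.of_step hu.overSig hu'.overSig hs))))
  | piCL hs ih =>
    obtain ⟨s, hA, hB, hD⟩ := h.piC_inv
    have hA' := ih hA
    exact hD.hasType
      (.piC hA' (hB.ctx_conf hT hA hA' (.symm (.of_step hA.overSig hA'.overSig hs))))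
  | piCR _ ih =>
    obtain ⟨s, hA, hB, hD⟩ := h.piC_inv
    exact hD.hasType (.piC hA (ih hB))
  | absC _ ih =>
    obtain ⟨A, B, s, hA, hB, ht, hD⟩ := h.absC_inv
    exact hD.hasType (.absC hA hB (ih ht))
  | appCL _ ih =>
    obtain ⟨A, B, ht, hl, hD⟩ := h.appC_inv
    exact hD.hasType (.appC (ih ht) hl)
  -- Reduction never takes place inside a level.
  | appCR hs => exact hs.not_false.elim

end WellFormed

end UPP

theorem mainTheorem5 {L : Type*} (Φ : List (Dedukti.Decl (UPP.Const L) UPP.arity))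
    (hΦ : (UPP.theory L).IsLocalSignature Φ)
    (Γ : Dedukti.Ctx (UPP.Const L) UPP.arity) (t t' A : Dedukti.Term (UPP.Const L) UPP.arity)
    (ht : Dedukti.HasType ((UPP.theory L).extend Φ) Γ t A)
    (hstep : ((UPP.theory L).extend Φ).Step t t') :
    Dedukti.HasType ((UPP.theory L).extend Φ) Γ t' A :=
  UPP.subject_reduction hΦ (Dedukti.Theory.step_iff.1 hstep) ht
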